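/- Let $p,q,i\ge 0$ be integers and let $Q(x)=x_1^2+\dots+x_p^2-x_{p+1}^2-\dots-x_{p+q}^2$ be the standard quadratic form on $\mathbb R^{p+q}$, let $SO(p,q)\subset SL(p+q,\mathbb R)$ be the group of matrices of determinant $1$ preserving $Q$, and let $Gr(i,\mathbb R^{p+q})$ be the Grassmannian of $i$-dimensional linear subspaces, with its standard smooth structure. A quadratic form has signature $(r,s)$ if $r$ and $s$ are the maximal dimensions of subspaces on which it is positive, respectively negative, definite. For $r,s\ge 0$ let $\mathcal O_{(r,s)}\subset Gr(i,\mathbb R^{p+q})$ be the set of subspaces $W$ such that $Q|_W$ has signature $(r,s)$. Each $\mathcal O_{(r,s)}$ is $SO(p,q)$-invariant and, if it is non-empty, it is a single $SO(p,q)$-orbit, except possibly if $p=q=i>0$ and $r=s=0$. Let $\mathcal O$ be either $\mathcal O_{(r,s)}$ or the $SO(p,q)$-orbit of a point of $\mathcal O_{(r,s)}$, and put $\nu=i-r-s$. Then $\mathcal O$ is an embedded smooth submanifold of $Gr(i,\mathbb R^{p+q})$. Moreover, for each point $x\in\mathcal O$ there are an open neighbourhood $U$ of $x$ in $Gr(i,\mathbb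 R^{p+q})$ and a diffeomorphism $\phi$ from $U$ onto an open neighbourhood of $(U\cap\mathcal O)\times\{0\}$ in $(U\cap\mathcal O)\times S^2\mathbb R^{\nu*}$, where $S^2\mathbb R^{\nu*}$ is the vector space of real symmetric $\nu\times\nu$ matrices, such that $U\subset\bigcup_{r'\ge r,\,s'\ge s}\mathcal O_{(r',s')}$ and such that, for all $r',s'\ge 0$, a point $y\in U$ lies in $\mathcal O_{(r',s')}$ if and only if $r'\ge r$, $s'\ge s$ and the second component of $\phi(y)$ has signature $(r'-r,s'-s)$. -/

import Mathlib

open Set Manifold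
open scoped ContDiff

noncomputable section

/-! ### The Grassmannian as a smooth manifold -/

/-- The Grassmannian of `i`-dimensional linear subspaces of the real vector space `V`. -/
def Gr (V : Type*) [AddCommGroup V] [Module ℝ V] (i : ℕ) : Type _ :=
  {W : Submodule ℝ V // Module.finrank ℝ W = i}

namespace Gr

section Charts

variable {V : Type*} [AddCommGroup V] [Module ℝ V]
variable {i k : ℕ}

/-- The affine parametrization of the Grassmannian defined by a linear isomorphism
`e : V ≃ ℝ^i × ℝ^k`: a linear map `A : ℝ^i → ℝ^k` goes to the subspace that corresponds to the
graph of `A`. -/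
def param (e : V ≃ₗ[ℝ] (Fin i → ℝ) × (Fin k → ℝ)) (A : (Fin i → ℝ) →L[ℝ] (Fin k → ℝ)) : Gr V i :=
  ⟨(A.toLinearMap.graph).comap e.toLinearMap, by
    have h1 : Module.finrank ℝ ((A.toLinearMap.graph).comap e.toLinearMap) =
        Module.finrank ℝ A.toLinearMap.graph :=
      ((e.submoduleMap _).finrank_eq).trans
        (by rw [Submodule.map_comap_eq_of_surjective e.surjective])
    rw [h1, LinearMap.graph_eq_range_prod, LinearMap.finrank_range_of_inj]
    · simp
    · intro x y h
      exact congrArg Prod.fst h⟩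

theorem mem_param (e : V ≃ₗ[ℝ] (Fin i → ℝ) × (Fin k → ℝ)) (A : (Fin i → ℝ) →L[ℝ] (Fin k → ℝ))
    (v : V) : v ∈ (param e A).1 ↔ (e v).2 = A (e v).1 := by
  simp [param]

theorem param_injective (e : V ≃ₗ[ℝ] (Fin i → ℝ) × (Fin k → ℝ)) :
    Function.Injective (param e) := by
  intro A B h
  ext1 x
  have h1 : e.symm (x, A x) ∈ (param e A).1 := by simp [mem_param]
  rw [h, mem_param] at h1
  simpa using h1

/-- The chart of the Grassmannian inverse to the affine parametrization `param e`; its domain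
consists of the subspaces that correspond to graphs under `e`. -/
def chart (e : V ≃ₗ[ℝ] (Fin i → ℝ) × (Fin k → ℝ)) :
    PartialEquiv (Gr V i) ((Fin i → ℝ) →L[ℝ] (Fin k → ℝ)) :=
  ((param_injective e).injOn.toPartialEquiv (param e) univ).symm

theorem chart_source (e : V ≃ₗ[ℝ] (Fin i → ℝ) × (Fin k → ℝ)) :
    (chart e).source = range (param e) := image_univ

theorem chart_target (e : V ≃ₗ[ℝ] (Fin i → ℝ) × (Fin k → ℝ)) :
    (chart e).target = univ := rfl

theorem chart_symm_apply (e : V ≃ₗ[ℝ] (Fin i → ℝ) × (Fin k → ℝ))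
    (A : (Fin i → ℝ) →L[ℝ] (Fin k → ℝ)) : (chart e).symm A = param e A := rfl

theorem chart_param (e : V ≃ₗ[ℝ] (Fin i → ℝ) × (Fin k → ℝ))
    (A : (Fin i → ℝ) →L[ℝ] (Fin k → ℝ)) : chart e (param e A) = A :=
  (chart e).right_inv (mem_univ A)

/-- The first component, in the coordinates `e'`, of the graph of `A` in the coordinates `e`. -/
def transFst (e e' : V ≃ₗ[ℝ] (Fin i → ℝ) × (Fin k → ℝ)) (A : (Fin i → ℝ) →L[ℝ] (Fin k → ℝ)) :
    (Fin i → ℝ) →L[ℝ] (Fin i → ℝ) :=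
  (ContinuousLinearMap.fst ℝ _ _).comp ((((e.symm.trans e').toContinuousLinearEquiv :
      ((Fin i → ℝ) × (Fin k → ℝ)) ≃L[ℝ] _) : _ →L[ℝ] (Fin i → ℝ) × (Fin k → ℝ)).comp
    (ContinuousLinearMap.inl ℝ _ _ + (ContinuousLinearMap.inr ℝ _ _).comp A))

/-- The second component, in the coordinates `e'`, of the graph of `A` in the coordinates `e`. -/
def transSnd (e e' : V ≃ₗ[ℝ] (Fin i → ℝ) × (Fin k → ℝ)) (A : (Fin i → ℝ) →L[ℝ] (Fin k → ℝ)) :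
    (Fin i → ℝ) →L[ℝ] (Fin k → ℝ) :=
  (ContinuousLinearMap.snd ℝ _ _).comp ((((e.symm.trans e').toContinuousLinearEquiv :
      ((Fin i → ℝ) × (Fin k → ℝ)) ≃L[ℝ] _) : _ →L[ℝ] (Fin i → ℝ) × (Fin k → ℝ)).comp
    (ContinuousLinearMap.inl ℝ _ _ + (ContinuousLinearMap.inr ℝ _ _).comp A))

theorem transFst_apply (e e' : V ≃ₗ[ℝ] (Fin i → ℝ) × (Fin k → ℝ))
    (A : (Fin i → ℝ) →L[ℝ] (Fin k → ℝ)) (x : Fin i → ℝ) :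
    transFst e e' A x = (e' (e.symm (x, A x))).1 := by
  have h : ((x, 0) : (Fin i → ℝ) × (Fin k → ℝ)) + (0, A x) = (x, A x) := by simp
  rw [← h, map_add, map_add]
  simp [transFst]

theorem transSnd_apply (e e' : V ≃ₗ[ℝ] (Fin i → ℝ) × (Fin k → ℝ))
    (A : (Fin i → ℝ) →L[ℝ] (Fin k → ℝ)) (x : Fin i → ℝ) :
    transSnd e e' A x = (e' (e.symm (x, A x))).2 := by
  have h : ((x, 0) : (Fin i → ℝ) × (Fin k → ℝ)) + (0, A x) = (x, A x) := by simp
  rw [← h, map_add, map_add]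
  simp [transSnd]

theorem contDiff_transFst (e e' : V ≃ₗ[ℝ] (Fin i → ℝ) × (Fin k → ℝ)) :
    ContDiff ℝ ∞ (transFst e e') := by
  unfold transFst
  exact contDiff_const.clm_comp (contDiff_const.clm_comp
    (contDiff_const.add (contDiff_const.clm_comp contDiff_id)))

theorem contDiff_transSnd (e e' : V ≃ₗ[ℝ] (Fin i → ℝ) × (Fin k → ℝ)) :
    ContDiff ℝ ∞ (transSnd e e') := by
  unfold transSnd
  exact contDiff_const.clm_comp (contDiff_const.clm_comp
    (contDiff_const.add (contDiff_const.clm_comp contDiff_id)))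

theorem isUnit_transFst_of_eq {e e' : V ≃ₗ[ℝ] (Fin i → ℝ) × (Fin k → ℝ)}
    {A B : (Fin i → ℝ) →L[ℝ] (Fin k → ℝ)} (h : param e A = param e' B) :
    IsUnit (transFst e e' A) := by
  rw [ContinuousLinearMap.isUnit_iff_bijective]
  have hinj : Function.Injective (transFst e e' A) := by
    rw [injective_iff_map_eq_zero]
    intro x hx
    have h1 : e.symm (x, A x) ∈ (param e A).1 := by simp [mem_param]
    rw [transFst_apply] at hx
    rw [h, mem_param, hx, map_zero] at h1
    have h2 : e' (e.symm (x, A x)) = 0 := Prod.ext hx h1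
    have h3 : (x, A x) = 0 := e.symm.injective (e'.injective (by rw [h2]; simp))
    exact congrArg Prod.fst h3
  exact ⟨hinj, LinearMap.injective_iff_surjective.1 hinj⟩

theorem param_eq_of_isUnit {e e' : V ≃ₗ[ℝ] (Fin i → ℝ) × (Fin k → ℝ)}
    {A : (Fin i → ℝ) →L[ℝ] (Fin k → ℝ)} (h : IsUnit (transFst e e' A)) :
    param e A = param e' ((transSnd e e' A).comp (Ring.inverse (transFst e e' A))) := by
  have hl : ∀ x, Ring.inverse (transFst e e' A) (transFst e e' A x) = x := fun x =>
    DFunLike.congr_fun (Ring.inverse_mul_cancel _ h) x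
  have hr : ∀ x, transFst e e' A (Ring.inverse (transFst e e' A) x) = x := fun x =>
    DFunLike.congr_fun (Ring.mul_inverse_cancel _ h) x
  apply Subtype.ext
  ext v
  rw [mem_param, mem_param]
  constructor
  · intro hv
    have hev : e.symm ((e v).1, A (e v).1) = v := by
      rw [← hv]
      simp
    have h1 : (e' v).1 = transFst e e' A (e v).1 := by rw [transFst_apply, hev]
    have h2 : (e' v).2 = transSnd e e' A (e v).1 := by rw [transSnd_apply, hev]
    rw [ContinuousLinearMap.comp_apply, h1, h2, hl]
  · intro hv
    set x := Ring.inverse (transFst e e' A) (e' v).1 with hx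
    have h1 : e' (e.symm (x, A x)) = e' v := by
      apply Prod.ext
      · rw [← transFst_apply, hx, hr]
      · rw [← transSnd_apply, hv, ContinuousLinearMap.comp_apply]
    have h2 : e v = (x, A x) := by
      rw [← e'.injective h1]
      simp
    rw [h2]

theorem trans_source (e e' : V ≃ₗ[ℝ] (Fin i → ℝ) × (Fin k → ℝ)) :
    ((chart e).symm.trans (chart e')).source = {A | IsUnit (transFst e e' A)} := by
  ext A
  rw [PartialEquiv.trans_source, chart_source]
  constructor
  · rintro ⟨-, B, hB⟩
    exact isUnit_transFst_of_eq hB.symm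
  · intro h
    exact ⟨mem_univ _, _, (param_eq_of_isUnit h).symm⟩

theorem isOpen_trans_source (e e' : V ≃ₗ[ℝ] (Fin i → ℝ) × (Fin k → ℝ)) :
    IsOpen ((chart e).symm.trans (chart e')).source := by
  rw [trans_source]
  exact Units.isOpen.preimage (contDiff_transFst e e').continuous

theorem contDiffOn_trans (e e' : V ≃ₗ[ℝ] (Fin i → ℝ) × (Fin k → ℝ)) :
    ContDiffOn ℝ ∞ ((chart e).symm.trans (chart e')) ((chart e).symm.trans (chart e')).source := by
  rw [trans_source]
  have h : ContDiffOn ℝ ∞ (fun A => (transSnd e e' A).comp (Ring.inverse (transFst e e' A)))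
      {A | IsUnit (transFst e e' A)} := by
    intro A hA
    obtain ⟨u, hu⟩ := id hA
    have h1 : ContDiffAt ℝ ∞ (Ring.inverse : ((Fin i → ℝ) →L[ℝ] (Fin i → ℝ)) → _)
        (transFst e e' A) := hu ▸ contDiffAt_ringInverse ℝ u
    exact ((contDiff_transSnd e e').contDiffAt.clm_comp
      (h1.comp A (contDiff_transFst e e').contDiffAt)).contDiffWithinAt
  refine h.congr fun A hA => ?_
  rw [PartialEquiv.coe_trans, Function.comp_apply, chart_symm_apply, param_eq_of_isUnit hA,
    chart_param]

end Charts

section Manifold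

variable {V : Type*} [AddCommGroup V] [Module ℝ V] [FiniteDimensional ℝ V] {i : ℕ}

theorem exists_mem_chart_source (W : Gr V i) :
    ∃ e : V ≃ₗ[ℝ] (Fin i → ℝ) × (Fin (Module.finrank ℝ V - i) → ℝ), W ∈ (chart e).source := by
  obtain ⟨C, hC⟩ := W.1.exists_isCompl
  have hW : Module.finrank ℝ W.1 = i := W.2
  have hd := Submodule.finrank_add_eq_of_isCompl hC
  let f : W.1 ≃ₗ[ℝ] (Fin i → ℝ) := LinearEquiv.ofFinrankEq _ _ (by simp [hW])
  let g : C ≃ₗ[ℝ] (Fin (Module.finrank ℝ V - i) → ℝ) :=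
    LinearEquiv.ofFinrankEq _ _ (by simp; omega)
  let e := (Submodule.prodEquivOfIsCompl _ _ hC).symm.trans (f.prodCongr g)
  refine ⟨e, ?_⟩
  rw [chart_source]
  refine ⟨0, Subtype.ext ?_⟩
  ext v
  rw [mem_param]
  simp [e]

/-- The affine charts of the Grassmannian; they define its topology and its smooth structure. -/
def chartedSpaceCore (V : Type*) [AddCommGroup V] [Module ℝ V] [FiniteDimensional ℝ V] (i : ℕ) :
    ChartedSpaceCore ((Fin i → ℝ) →L[ℝ] (Fin (Module.finrank ℝ V - i) → ℝ)) (Gr V i) where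
  atlas := range chart
  chartAt W := chart (exists_mem_chart_source W).choose
  mem_chart_source W := (exists_mem_chart_source W).choose_spec
  chart_mem_atlas W := mem_range_self _
  open_source := by
    rintro _ _ ⟨e, rfl⟩ ⟨e', rfl⟩
    exact isOpen_trans_source e e'
  continuousOn_toFun := by
    rintro _ _ ⟨e, rfl⟩ ⟨e', rfl⟩
    exact (contDiffOn_trans e e').continuousOn

instance instTopologicalSpace : TopologicalSpace (Gr V i) :=
  (chartedSpaceCore V i).toTopologicalSpace

instance instChartedSpace :
    ChartedSpace ((Fin i → ℝ) →L[ℝ] (Fin (Module.finrank ℝ V - i) → ℝ)) (Gr V i) :=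
  (chartedSpaceCore V i).toChartedSpace

instance instIsManifold :
    IsManifold 𝓘(ℝ, (Fin i → ℝ) →L[ℝ] (Fin (Module.finrank ℝ V - i) → ℝ)) ∞ (Gr V i) := by
  apply isManifold_of_contDiffOn
  intro c c' hc hc'
  obtain ⟨_, ⟨_, rfl⟩, hc⟩ := hc
  obtain ⟨_, ⟨_, rfl⟩, hc'⟩ := hc'
  simp only [mem_iUnion, mem_singleton_iff] at hc hc'
  obtain ⟨⟨e, rfl⟩, rfl⟩ := hc
  obtain ⟨⟨e', rfl⟩, rfl⟩ := hc'
  simpa using! contDiffOn_trans e e'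

end Manifold

section Action

variable {ι : Type*} [Fintype ι] [DecidableEq ι] {i : ℕ}

/-- The natural action of the special linear group on the Grassmannian: `A • W` is the image of
the subspace `W` under the linear map with matrix `A`. -/
instance instMulAction : MulAction (Matrix.SpecialLinearGroup ι ℝ) (Gr (ι → ℝ) i) where
  smul A W := ⟨W.1.map (Matrix.SpecialLinearGroup.toLin' A).toLinearMap,
    (LinearEquiv.finrank_map_eq _ _).trans W.2⟩
  one_smul W := by
    apply Subtype.ext
    change Submodule.map _ _ = _
    ext v
    simp
  mul_smul A B W := by
    apply Subtype.ext
    change Submodule.map _ _ = Submodule.map _ (Submodule.map _ _)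
    rw [← Submodule.map_comp]
    congr 1
    ext v
    simp

end Action

end Gr

/-! ### The group `SO(p,q)` and its orbits -/

/-- The index set of the coordinates on `ℝ^{p+q}`: first `p` coordinates, then `q` coordinates. -/
abbrev Idx (p q : ℕ) : Type := Fin p ⊕ Fin q

/-- The matrix `I_{p,q} = diag(1, …, 1, -1, …, -1)` with `p` entries `1` and `q` entries `-1`. -/
abbrev Ipq (p q : ℕ) : Matrix (Idx p q) (Idx p q) ℝ :=
  LieAlgebra.Orthogonal.indefiniteDiagonal (Fin p) (Fin q) ℝ

/-- The indefinite special orthogonal group `SO(p,q)`, as a subgroup of `SL(p+q, ℝ)`. -/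
def SO (p q : ℕ) : Subgroup (Matrix.SpecialLinearGroup (Idx p q) ℝ) where
  carrier := {A | A.1.transpose * Ipq p q * A.1 = Ipq p q}
  one_mem' := by simp
  mul_mem' := by
    intro A B hA hB
    simp only [mem_ofPred_eq] at *
    calc (A * B).1.transpose * Ipq p q * (A * B).1
        = B.1.transpose * (A.1.transpose * Ipq p q * A.1) * B.1 := by
          simp only [Matrix.SpecialLinearGroup.coe_mul, Matrix.transpose_mul, Matrix.mul_assoc]
      _ = Ipq p q := by rw [hA, hB]
  inv_mem' := by
    intro A hA
    simp only [mem_ofPred_eq] at *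
    have h : A.1 * (A⁻¹).1 = 1 := by
      rw [← Matrix.SpecialLinearGroup.coe_mul, mul_inv_cancel, Matrix.SpecialLinearGroup.coe_one]
    have h' : (A⁻¹).1.transpose * A.1.transpose = 1 := by
      rw [← Matrix.transpose_mul, h, Matrix.transpose_one]
    calc (A⁻¹).1.transpose * Ipq p q * (A⁻¹).1
        = (A⁻¹).1.transpose * (A.1.transpose * Ipq p q * A.1) * (A⁻¹).1 := by rw [hA]
      _ = ((A⁻¹).1.transpose * A.1.transpose) * Ipq p q * (A.1 * (A⁻¹).1) := by
          simp only [Matrix.mul_assoc]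
      _ = Ipq p q := by rw [h, h', Matrix.one_mul, Matrix.mul_one]

/-- A quadratic form has signature `(r, s)` if the maximal dimensions of positive definite and of
negative definite subspaces are `r` and `s`. -/
def HasSignature {M : Type*} [AddCommGroup M] [Module ℝ M] (Q : QuadraticForm ℝ M) (r s : ℕ) :
    Prop :=
  sigPos Q = r ∧ sigNeg Q = s

/-- `O_{(r,s)}`: the set of all `i`-dimensional subspaces of `ℝ^{p+q}` on which the quadratic form
`x₁² + … + x_p² - x_{p+1}² - … - x_{p+q}²` has signature `(r, s)`. -/
def orbitOfType (p q i r s : ℕ) : Set (Gr (Idx p q → ℝ) i) :=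
  {W | HasSignature ((Ipq p q).toQuadraticForm'.restrict W.1) r s}

/-- The normed space of symmetric `ν × ν` matrices (with the maximum norm). -/
abbrev SymMat (ν : ℕ) : Type :=
  ({ carrier := {S | (Matrix.of S).IsSymm}
     add_mem' := fun hS hT => Matrix.IsSymm.add hS hT
     zero_mem' := Matrix.isSymm_zero
     smul_mem' := fun c _ hS => Matrix.IsSymm.smul hS c } : Submodule ℝ (Fin ν → Fin ν → ℝ))

/-- The quadratic form `x ↦ xᵀ S x` of a symmetric matrix `S`. -/
def SymMat.form {ν : ℕ} (S : SymMat ν) : QuadraticForm ℝ (Fin ν → ℝ) :=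
  (Matrix.of S.1).toQuadraticForm'

/-- The model vector space of the Grassmannian of `i`-dimensional subspaces of `ℝ^{p+q}`. -/
abbrev GrModel (p q i : ℕ) : Type :=
  (Fin i → ℝ) →L[ℝ] (Fin (Module.finrank ℝ (Idx p q → ℝ) - i) → ℝ)

end

/-!
The theorem is an explicit version of the following picture. Let `W₀` have signature `(r, s)` and let
`ν = i - r - s` be the dimension of the radical of `Q|W₀`.

*Witt frames.* The quadratic space `ℝ^{p+q}` splits as `(P ⊕ N) ⊕ (N* ⊕ R)` with `W₀ = P ⊕ N`, where
`P` is nondegenerate of signature `(r, s)`, where `N` is the radical of `W₀` and `N*` an isotropic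
subspace in duality with it, and where `R` is nondegenerate and orthogonal to the rest
(`exists_wittFrame`). The signature of `R` is determined by `p, q, r, s, ν` (`WittFrame.dim_eq`), so
two subspaces of the same signature correspond under an isometry of `ℝ^{p+q}`. Its determinant is
`±1`; if `P` or `R` is nonzero, a reflection in a vector of `P` or `R` preserves `W₀` and corrects the
sign (`WittFrame.mem_orbit`). If both vanish then `p = q = ν = i`, which is the exceptional case.

*Schur complements.* Subspaces near `W₀` are graphs of maps `A : P ⊕ N → N* ⊕ R`. While the Gram form
of the graph stays nondegenerate of signature `(r, s)` on `P`, its signature is `(r, s)` plus the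
signature of its Schur complement `schur A`, a symmetric `ν × ν` matrix (`hasSignature_gram_iff`).
Adding to `A` the map `N → N*` with matrix `T / 2` changes `schur A` by exactly `T` and leaves the
block on `P` alone (`schur_add_schurSection`). So `schur` is a submersion that is affine along a
linear section, and it can be completed to a smooth chart with an explicit inverse
(`exists_straightening`). In this chart the subspaces of signature `(r, s)` are the locus `schur = 0`.

*Gluing.* Charts of this kind make a subset of a manifold into an embedded submanifold, and each of
them defines a product neighbourhood of the subset; this is the content of `SliceChart`. A single
orbit is treated by the same charts as `𝒪_(r,s)`, since it is open in `𝒪_(r,s)`. Only the exceptional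
case needs an argument: there the orbit contains all isotropic graphs over its points, because the
shear along a graph is the square of an isometry, hence of determinant `1`
(`WittFrame.mem_orbit_of_graph`).
-/

/-! ### Submanifolds given by slice charts -/

section Slice

variable {E K F N : Type*} [NormedAddCommGroup E] [NormedSpace ℝ E] [NormedAddCommGroup K]
  [NormedSpace ℝ K] [NormedAddCommGroup F] [NormedSpace ℝ F] [TopologicalSpace N]
  [ChartedSpace E N]

/-- A slice chart of the subset `O` of the manifold `N`, relative to a splitting `Θ : E ≃ K × F` of
the model space: a smooth chart in which `O` becomes the locus where the `F`-component vanishes.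
Its target is required to be a union of whole fibres of the projection to `K`. -/
structure SliceChart (Θ : E ≃L[ℝ] K × F) (O : Set N) where
  /-- The underlying chart of the ambient manifold. -/
  chart : OpenPartialHomeomorph N E
  mem_maximalAtlas : chart ∈ IsManifold.maximalAtlas 𝓘(ℝ, E) ∞ N
  mem_iff : ∀ y ∈ chart.source, (y ∈ O ↔ (Θ (chart y)).2 = 0)
  target_saturated : ∀ z ∈ chart.target, ∀ T : F, Θ.symm ((Θ z).1, T) ∈ chart.target

namespace SliceChart

variable {Θ : E ≃L[ℝ] K × F} {O : Set N} (c : SliceChart Θ O)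

theorem symm_mem {k : K} (hk : Θ.symm (k, 0) ∈ c.chart.target) :
    c.chart.symm (Θ.symm (k, 0)) ∈ O := by
  rw [c.mem_iff _ (c.chart.map_target hk), c.chart.right_inv hk]
  simp

theorem symm_fst_chart {y : N} (hy : y ∈ c.chart.source) (hO : y ∈ O) :
    Θ.symm ((Θ (c.chart y)).1, 0) = c.chart y := by
  rw [Θ.symm_apply_eq, ← (c.mem_iff y hy).1 hO]

open Classical in
/-- The chart of `O` with values in `K` induced by a slice chart; the point `x` of `O` only serves
as the value of the inverse outside the target. -/
noncomputable def induced (x : O) : OpenPartialHomeomorph O K where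
  toFun y := (Θ (c.chart y)).1
  invFun k := if h : Θ.symm (k, 0) ∈ c.chart.target then
    ⟨c.chart.symm (Θ.symm (k, 0)), c.symm_mem h⟩ else x
  source := {y | y.1 ∈ c.chart.source}
  target := {k | Θ.symm (k, 0) ∈ c.chart.target}
  map_source' y hy := by
    change Θ.symm ((Θ (c.chart y)).1, 0) ∈ c.chart.target
    rw [c.symm_fst_chart hy y.2]
    exact c.chart.map_source hy
  map_target' k hk := by
    have hk' : Θ.symm (k, 0) ∈ c.chart.target := hk
    simp [hk', c.chart.map_target hk']
  left_inv' y hy := by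
    have h1 := c.symm_fst_chart hy y.2
    have h2 : Θ.symm ((Θ (c.chart y)).1, 0) ∈ c.chart.target := by
      rw [h1]
      exact c.chart.map_source hy
    rw [dif_pos h2]
    apply Subtype.ext
    simp only [h1]
    exact c.chart.left_inv hy
  right_inv' k hk := by
    have hk' : Θ.symm (k, 0) ∈ c.chart.target := hk
    simp only [hk', dif_pos]
    rw [c.chart.right_inv hk']
    simp
  open_source := c.chart.open_source.preimage continuous_subtype_val
  open_target := c.chart.open_target.preimage (by fun_prop)
  continuousOn_toFun := by
    refine (continuous_fst.comp Θ.continuous).comp_continuousOn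
      (c.chart.continuousOn.comp continuous_subtype_val.continuousOn fun y hy => hy)
  continuousOn_invFun := by
    rw [Topology.IsInducing.subtypeVal.continuousOn_iff]
    have h : ContinuousOn (fun k : K => c.chart.symm (Θ.symm (k, 0)))
        {k | Θ.symm (k, 0) ∈ c.chart.target} :=
      c.chart.continuousOn_symm.comp (by fun_prop) fun k hk => hk
    refine h.congr fun k hk => ?_
    have hk' : Θ.symm (k, 0) ∈ c.chart.target := hk
    simp [hk']

theorem induced_source (x : O) : (c.induced x).source = {y | y.1 ∈ c.chart.source} := rfl

theorem induced_target (x : O) :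
    (c.induced x).target = {k | Θ.symm (k, 0) ∈ c.chart.target} := rfl

theorem induced_apply (x y : O) : c.induced x y = (Θ (c.chart y)).1 := rfl

theorem induced_symm_apply (x : O) {k : K} (hk : Θ.symm (k, 0) ∈ c.chart.target) :
    ((c.induced x).symm k : N) = c.chart.symm (Θ.symm (k, 0)) := by
  simp [induced, hk]

variable (C : O → SliceChart Θ O) (hC : ∀ x : O, x.1 ∈ (C x).chart.source)

/-- The atlas of `O` induced by a family of slice charts. -/
@[reducible]
noncomputable def chartedSpace : ChartedSpace K O where
  atlas := range fun x : O => (C x).induced x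
  chartAt x := (C x).induced x
  mem_chart_source := hC
  chart_mem_atlas x := mem_range_self x

theorem contDiffOn_induced_trans [IsManifold 𝓘(ℝ, E) ∞ N] (c c' : SliceChart Θ O) (x x' : O) :
    ContDiffOn ℝ ∞ ((c.induced x).symm.trans (c'.induced x'))
      ((c.induced x).symm.trans (c'.induced x')).source := by
  have h1 := contMDiffOn_symm_of_mem_maximalAtlas c.mem_maximalAtlas
  have h2 := contMDiffOn_of_mem_maximalAtlas c'.mem_maximalAtlas
  have h3 : ContDiffOn ℝ ∞ (c'.chart ∘ c.chart.symm)
      (c.chart.target ∩ c.chart.symm ⁻¹' c'.chart.source) :=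
    contMDiffOn_iff_contDiffOn.1 (h2.comp' h1)
  have h4 : ContDiffOn ℝ ∞ (fun k : K => (Θ ((c'.chart ∘ c.chart.symm) (Θ.symm (k, 0)))).1)
      ((c.induced x).symm.trans (c'.induced x')).source := by
    refine contDiff_fst.comp_contDiffOn (Θ.contDiff.comp_contDiffOn
      (h3.comp (f := fun k : K => Θ.symm (k, 0)) ?_ ?_))
    · exact (Θ.symm.contDiff.comp (contDiff_id.prodMk contDiff_const)).contDiffOn
    · intro k hk
      have hk1 : Θ.symm (k, 0) ∈ c.chart.target := hk.1
      refine ⟨hk1, ?_⟩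
      have hk2 : ((c.induced x).symm k : N) ∈ c'.chart.source := hk.2
      rwa [c.induced_symm_apply x hk1] at hk2
  refine h4.congr fun k hk => ?_
  have hk1 : Θ.symm (k, 0) ∈ c.chart.target := hk.1
  change (Θ (c'.chart ((c.induced x).symm k : N))).1 = _
  rw [c.induced_symm_apply x hk1]
  rfl

theorem isManifold [IsManifold 𝓘(ℝ, E) ∞ N] :
    letI := chartedSpace C hC
    IsManifold 𝓘(ℝ, K) ∞ O := by
  let := chartedSpace C hC
  apply isManifold_of_contDiffOn
  rintro _ _ ⟨x, rfl⟩ ⟨x', rfl⟩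
  simpa using! contDiffOn_induced_trans (C x) (C x') x x'

/-- In the charts `C x` and `induced x`, the inclusion of `O` is `k ↦ (k, 0)`. -/
theorem isSmoothEmbedding_val [IsManifold 𝓘(ℝ, E) ∞ N] :
    letI := chartedSpace C hC
    IsSmoothEmbedding 𝓘(ℝ, K) 𝓘(ℝ, E) ∞ (Subtype.val : O → N) := by
  let := chartedSpace C hC
  have := isManifold C hC
  refine ⟨?_, Topology.IsEmbedding.subtypeVal⟩
  have h : IsImmersionOfComplement F 𝓘(ℝ, K) 𝓘(ℝ, E) ∞ (Subtype.val : O → N) := by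
    intro x
    refine .mk_of_charts Θ.symm ((C x).induced x) (C x).chart (hC x) (hC x)
      (IsManifold.subset_maximalAtlas (mem_range_self x)) (C x).mem_maximalAtlas
      (fun y hy => hy) ?_
    intro k hk
    have hk1 : Θ.symm (k, 0) ∈ (C x).chart.target := by simpa [induced_target] using hk
    have h1 := (C x).induced_symm_apply x hk1
    simp [h1, (C x).chart.right_inv hk1]
  exact h.isImmersion

/-- The local product structure transverse to `O` defined by a slice chart. -/
noncomputable def tube (x : O) : OpenPartialHomeomorph N (O × F) :=
  (c.chart.trans Θ.toHomeomorph.toOpenPartialHomeomorph).trans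
    ((c.induced x).symm.prod (OpenPartialHomeomorph.refl F))

theorem tube_source (x : O) : (c.tube x).source = c.chart.source := by
  ext y
  have h : y ∈ c.chart.source → Θ.symm ((Θ (c.chart y)).1, 0) ∈ c.chart.target := fun hy =>
    c.target_saturated _ (c.chart.map_source hy) 0
  simpa [tube, induced_target] using h

theorem tube_snd (x : O) (y : N) : (c.tube x y).2 = (Θ (c.chart y)).2 := rfl

/-- The target is a full product because the target of a slice chart is saturated. -/
theorem tube_target (x : O) : (c.tube x).target = {z | z.1.1 ∈ c.chart.source} := by
  ext z
  have h : z.1.1 ∈ c.chart.source → Θ.symm ((Θ (c.chart z.1)).1, z.2) ∈ c.chart.target :=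
    fun hz => c.target_saturated _ (c.chart.map_source hz) _
  simpa [tube, induced_source, induced_apply] using h

theorem contMDiffOn_tube [IsManifold 𝓘(ℝ, E) ∞ N] (x : O) :
    letI := chartedSpace C hC
    ContMDiffOn 𝓘(ℝ, E) (𝓘(ℝ, K).prod 𝓘(ℝ, F)) ∞ ((C x).tube x) ((C x).tube x).source := by
  let := chartedSpace C hC
  have := isManifold C hC
  have h1 := contMDiffOn_of_mem_maximalAtlas (C x).mem_maximalAtlas
  have h2 : (C x).induced x ∈ IsManifold.maximalAtlas 𝓘(ℝ, K) ∞ O :=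
    IsManifold.subset_maximalAtlas (mem_range_self x)
  have h3 := contMDiffOn_symm_of_mem_maximalAtlas h2
  have h4 : ContMDiffOn 𝓘(ℝ, E) 𝓘(ℝ, K × F) ∞ (fun y => Θ ((C x).chart y)) (C x).chart.source :=
    Θ.contDiff.contMDiff.comp_contMDiffOn h1
  have h5 : ContMDiffOn 𝓘(ℝ, E) 𝓘(ℝ, K) ∞ (fun y => (Θ ((C x).chart y)).1) (C x).chart.source :=
    contDiff_fst.contMDiff.comp_contMDiffOn h4
  have h6 : ContMDiffOn 𝓘(ℝ, E) 𝓘(ℝ, F) ∞ (fun y => (Θ ((C x).chart y)).2) (C x).chart.source :=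
    contDiff_snd.contMDiff.comp_contMDiffOn h4
  rw [tube_source]
  exact (h3.comp h5 fun y hy => (C x).target_saturated _ ((C x).chart.map_source hy) 0).prodMk h6

theorem contMDiffOn_tube_symm [IsManifold 𝓘(ℝ, E) ∞ N] (x : O) :
    letI := chartedSpace C hC
    ContMDiffOn (𝓘(ℝ, K).prod 𝓘(ℝ, F)) 𝓘(ℝ, E) ∞ ((C x).tube x).symm ((C x).tube x).target := by
  let := chartedSpace C hC
  have := isManifold C hC
  have h1 := contMDiffOn_symm_of_mem_maximalAtlas (C x).mem_maximalAtlas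
  have h2 : (C x).induced x ∈ IsManifold.maximalAtlas 𝓘(ℝ, K) ∞ O :=
    IsManifold.subset_maximalAtlas (mem_range_self x)
  have h3 := contMDiffOn_of_mem_maximalAtlas h2
  rw [tube_target]
  have h4 : ContMDiffOn (𝓘(ℝ, K).prod 𝓘(ℝ, F)) 𝓘(ℝ, K × F) ∞
      (fun z : O × F => ((C x).induced x z.1, z.2)) {z | z.1.1 ∈ (C x).chart.source} :=
    (h3.comp contMDiff_fst.contMDiffOn fun z hz => hz).prodMk_space contMDiff_snd.contMDiffOn
  have h5 : ContMDiffOn (𝓘(ℝ, K).prod 𝓘(ℝ, F)) 𝓘(ℝ, E) ∞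
      (fun z : O × F => Θ.symm ((C x).induced x z.1, z.2)) {z | z.1.1 ∈ (C x).chart.source} :=
    Θ.symm.contDiff.contMDiff.comp_contMDiffOn h4
  exact h1.comp h5 fun z hz => (C x).target_saturated _ ((C x).chart.map_source hz) _

end SliceChart

end Slice

/-! ### Signatures of real quadratic forms -/

section Signature

variable {M M' X Y : Type*} [AddCommGroup M] [Module ℝ M] [AddCommGroup M'] [Module ℝ M']
  [AddCommGroup X] [Module ℝ X] [AddCommGroup Y] [Module ℝ Y]

theorem HasSignature.congr {Q : QuadraticForm ℝ M} {Q' : QuadraticForm ℝ M'}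
    (h : QuadraticMap.Equivalent Q Q') (r s : ℕ) : HasSignature Q r s ↔ HasSignature Q' r s := by
  rw [HasSignature, HasSignature, h.sigPos_eq, h.sigNeg_eq]

variable [FiniteDimensional ℝ M] [FiniteDimensional ℝ M']

theorem finrank_le_sigPos {Q : QuadraticForm ℝ M} (g : X →ₗ[ℝ] M) (hg : ∀ x ≠ 0, 0 < Q (g x)) :
    Module.finrank ℝ X ≤ sigPos Q := by
  have hinj : Function.Injective g := by
    rw [injective_iff_map_eq_zero]
    intro x hx
    by_contra h
    simpa [hx] using hg x h
  rw [← LinearMap.finrank_range_of_inj hinj]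
  apply le_sigPos_of_posDef
  rintro ⟨_, x, rfl⟩ hx
  apply hg
  rintro rfl
  simp at hx

theorem finrank_le_sigNeg {Q : QuadraticForm ℝ M} (g : X →ₗ[ℝ] M) (hg : ∀ x ≠ 0, Q (g x) < 0) :
    Module.finrank ℝ X ≤ sigNeg Q :=
  finrank_le_sigPos (Q := -Q) g (by simpa using hg)

theorem hasSignature_of_posDef_of_negDef {Q : QuadraticForm ℝ M} (g : X →ₗ[ℝ] M)
    (hg : ∀ x ≠ 0, 0 < Q (g x)) (g' : Y →ₗ[ℝ] M) (hg' : ∀ x ≠ 0, Q (g' x) < 0)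
    (h : Module.finrank ℝ M ≤ Module.finrank ℝ X + Module.finrank ℝ Y) :
    HasSignature Q (Module.finrank ℝ X) (Module.finrank ℝ Y) ∧
      Module.finrank ℝ Q.radical = 0 := by
  have h1 := finrank_le_sigPos g hg
  have h2 := finrank_le_sigNeg g' hg'
  have h3 := QuadraticForm.sigPos_add_sigNeg_add_radical (Q := Q)
  exact ⟨⟨by omega, by omega⟩, by omega⟩

theorem sigPos_add_le_sigPos_prod (Q : QuadraticForm ℝ M) (Q' : QuadraticForm ℝ M') :
    sigPos Q + sigPos Q' ≤ sigPos (Q.prod Q') := by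
  obtain ⟨P, hP, hP'⟩ := exists_finrank_eq_sigPos_and_posDef Q
  obtain ⟨N, hN, hN'⟩ := exists_finrank_eq_sigPos_and_posDef Q'
  rw [← hP, ← hN, ← Module.finrank_prod]
  exact finrank_le_sigPos (P.subtype.prodMap N.subtype) (hP'.prod hN')

/-- The signature of an orthogonal sum is the sum of the signatures. -/
theorem hasSignature_prod (Q : QuadraticForm ℝ M) (Q' : QuadraticForm ℝ M') :
    HasSignature (Q.prod Q') (sigPos Q + sigPos Q') (sigNeg Q + sigNeg Q') := by
  have h1 := sigPos_add_le_sigPos_prod Q Q'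
  have h2 : sigNeg Q + sigNeg Q' ≤ sigNeg (Q.prod Q') := by
    refine (sigPos_add_le_sigPos_prod (-Q) (-Q')).trans_eq ?_
    rw [← sigPos_neg]
    congr 1
    ext z
    simp
    ring
  have h3 := QuadraticForm.sigPos_add_sigNeg_add_radical (Q := Q)
  have h4 := QuadraticForm.sigPos_add_sigNeg_add_radical (Q := Q')
  have h5 := QuadraticForm.sigPos_add_sigNeg_add_radical (Q := Q.prod Q')
  have h6 : Module.finrank ℝ Q.radical + Module.finrank ℝ Q'.radical ≤
      Module.finrank ℝ (Q.prod Q').radical := by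
    rw [← Module.finrank_prod]
    let g : Q.radical × Q'.radical →ₗ[ℝ] (Q.prod Q').radical :=
      (Q.radical.subtype.prodMap Q'.radical.subtype).codRestrict _ (by
        rintro ⟨⟨x, hx⟩, ⟨y, hy⟩⟩
        rw [QuadraticMap.mem_radical_iff'] at hx hy ⊢
        refine ⟨?_, ?_⟩
        · simp [QuadraticMap.prod_apply, hx.1, hy.1]
        · rintro ⟨x', y'⟩
          simp [QuadraticMap.prod_apply, hx.2, hy.2])
    apply LinearMap.finrank_le_finrank_of_injective (f := g)
    rintro ⟨x, y⟩ ⟨x', y'⟩ h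
    have h' : (x.1, y.1) = (x'.1, y'.1) := congrArg Subtype.val h
    exact Prod.ext (Subtype.ext (congrArg Prod.fst h')) (Subtype.ext (congrArg Prod.snd h'))
  rw [Module.finrank_prod] at h5
  exact ⟨by omega, by omega⟩

/-! ### The standard form of signature `(p, q)` -/

/-- The symmetric bilinear form on `ℝ^{p+q}` with matrix `I_{p,q}`. -/
noncomputable def pqForm (p q : ℕ) : LinearMap.BilinForm ℝ (Idx p q → ℝ) :=
  Matrix.toLinearMap₂' ℝ (Ipq p q)

theorem pqForm_apply (p q : ℕ) (x y : Idx p q → ℝ) :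
    pqForm p q x y = ∑ j, x (Sum.inl j) * y (Sum.inl j) - ∑ j, x (Sum.inr j) * y (Sum.inr j) := by
  rw [pqForm, Matrix.toLinearMap₂'_apply']
  simp [dotProduct, Ipq, LieAlgebra.Orthogonal.indefiniteDiagonal, Matrix.mulVec_diagonal,
    sub_eq_add_neg]

theorem toQuadraticForm'_Ipq_apply (p q : ℕ) (x : Idx p q → ℝ) :
    (Ipq p q).toQuadraticForm' x = pqForm p q x x := rfl

theorem pqForm_comm (p q : ℕ) (x y : Idx p q → ℝ) : pqForm p q x y = pqForm p q y x := by
  simp [pqForm_apply, mul_comm]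

theorem dotProduct_self_pos {ι : Type*} [Fintype ι] {x : ι → ℝ} (hx : x ≠ 0) : 0 < x ⬝ᵥ x :=
  lt_of_le_of_ne (Finset.sum_nonneg fun _ _ => mul_self_nonneg _)
    fun h => hx (dotProduct_self_eq_zero.1 h.symm)

/-- The inclusion of the positive coordinates `ℝ^p → ℝ^{p+q}`. -/
noncomputable def pqInl (p q : ℕ) : (Fin p → ℝ) →ₗ[ℝ] (Idx p q → ℝ) :=
  (LinearEquiv.sumArrowLequivProdArrow (Fin p) (Fin q) ℝ ℝ).symm.toLinearMap ∘ₗ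
    LinearMap.inl ℝ _ _

/-- The inclusion of the negative coordinates `ℝ^q → ℝ^{p+q}`. -/
noncomputable def pqInr (p q : ℕ) : (Fin q → ℝ) →ₗ[ℝ] (Idx p q → ℝ) :=
  (LinearEquiv.sumArrowLequivProdArrow (Fin p) (Fin q) ℝ ℝ).symm.toLinearMap ∘ₗ
    LinearMap.inr ℝ _ _

theorem pqForm_pqInl (p q : ℕ) (x y : Fin p → ℝ) :
    pqForm p q (pqInl p q x) (pqInl p q y) = x ⬝ᵥ y := by
  simp [pqForm_apply, pqInl, dotProduct]

theorem pqForm_pqInr (p q : ℕ) (x y : Fin q → ℝ) :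
    pqForm p q (pqInr p q x) (pqInr p q y) = -(x ⬝ᵥ y) := by
  simp [pqForm_apply, pqInr, dotProduct]

theorem hasSignature_pqForm (p q : ℕ) : HasSignature (Ipq p q).toQuadraticForm' p q := by
  have h := (hasSignature_of_posDef_of_negDef (Q := (Ipq p q).toQuadraticForm')
    (pqInl p q) (fun x hx => ?_) (pqInr p q) (fun x hx => ?_) (by simp)).1
  · simpa using h
  · rw [toQuadraticForm'_Ipq_apply, pqForm_pqInl]
    exact dotProduct_self_pos hx
  · rw [toQuadraticForm'_Ipq_apply, pqForm_pqInr, neg_lt_zero]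
    exact dotProduct_self_pos hx

theorem pqForm_eq_zero {p q : ℕ} {x : Idx p q → ℝ} (h : ∀ y, pqForm p q x y = 0) : x = 0 := by
  ext j
  rcases j with j | j
  · simpa [pqForm_apply, Pi.single_apply] using h (Pi.single (Sum.inl j) 1)
  · simpa [pqForm_apply, Pi.single_apply] using h (Pi.single (Sum.inr j) 1)

/-- The norm on `Idx p q → ℝ` is the maximum norm, which is bounded by the Euclidean norm. -/
theorem norm_sq_le_sum_sq (p q : ℕ) (x : Idx p q → ℝ) : ‖x‖ ^ 2 ≤ ∑ j, x j ^ 2 := by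
  have h : ‖x‖ ≤ √(∑ j, x j ^ 2) := by
    refine (pi_norm_le_iff_of_nonneg (Real.sqrt_nonneg _)).2 fun j => ?_
    apply Real.le_sqrt_of_sq_le
    rw [Real.norm_eq_abs, sq_abs]
    exact Finset.single_le_sum (f := fun j => x j ^ 2) (fun i _ => sq_nonneg _) (Finset.mem_univ j)
  calc ‖x‖ ^ 2 ≤ √(∑ j, x j ^ 2) ^ 2 := by gcongr
    _ = _ := Real.sq_sqrt (Finset.sum_nonneg fun i _ => sq_nonneg _)

/-- **Sylvester's law of inertia** in coordinates: a form of signature `(r, s)` is the sum of the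
standard form and of a zero form. -/
theorem exists_equiv_pqForm {Q : QuadraticForm ℝ M} {r s ν : ℕ} (h : HasSignature Q r s)
    (hν : Module.finrank ℝ M = r + s + ν) :
    ∃ f : M ≃ₗ[ℝ] (Idx r s → ℝ) × (Fin ν → ℝ), ∀ m, Q m = pqForm r s (f m).1 (f m).1 := by
  obtain ⟨w, hw⟩ := QuadraticForm.equivalent_signType_weighted_sum_squared Q
  let w' : Idx r s ⊕ Fin ν → SignType := Sum.elim (Sum.elim (fun _ => 1) fun _ => -1) fun _ => 0
  have hsign : ∀ c : SignType, (c = 1 ↔ 0 < (c : ℝ)) ∧ (c = -1 ↔ (c : ℝ) < 0) ∧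
      (c = 0 ↔ (c : ℝ) = 0) := by
    intro c
    cases c <;> simp
  have hp : {i | w i = 1}.ncard = r := by
    rw [← h.1, QuadraticForm.sigPos_of_equiv_weightedSumSquares hw]
    exact congrArg _ (Set.ext fun i => (hsign _).1)
  have hn : {i | w i = -1}.ncard = s := by
    rw [← h.2, QuadraticForm.sigNeg_of_equiv_weightedSumSquares hw]
    exact congrArg _ (Set.ext fun i => (hsign _).2.1)
  have h0 : {i | w i = 0}.ncard = ν := by
    have h1 := QuadraticForm.finrank_radical_of_equiv_weightedSumSquares hw
    have h2 := QuadraticForm.sigPos_add_sigNeg_add_radical (Q := Q)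
    have h3 : {i | w i = 0} = {i | ((w i : SignType) : ℝ) = 0} :=
      Set.ext fun i => (hsign _).2.2
    rw [h3, ← h1]
    obtain ⟨h4, h5⟩ := h
    omega
  have hc : ∀ c : SignType, {i | w i = c}.ncard = {i | w' i = c}.ncard := by
    intro c
    have h1 : {i | w' i = c}.ncard = ∑ i, if w' i = c then 1 else 0 := by
      rw [Set.ncard_eq_toFinset_card', Finset.card_eq_sum_ones, Finset.sum_ite]
      simp
    rw [h1, Fintype.sum_sum_type, Fintype.sum_sum_type]
    rcases c with _ | _ | _
    · simpa [w'] using h0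
    · simpa [w'] using hn
    · simpa [w'] using hp
  let σ : Fin (Module.finrank ℝ M) ≃ Idx r s ⊕ Fin ν :=
    Equiv.ofFiberEquiv (f := w) (g := w') fun c => Classical.choice (Finite.card_eq.1 (hc c))
  have hσ : ∀ j, w' (σ j) = w j := fun j => Equiv.ofFiberEquiv_map _ j
  obtain ⟨e⟩ := hw
  let g := (e.toLinearEquiv.trans (LinearEquiv.funCongrLeft ℝ ℝ σ.symm)).trans
    (LinearEquiv.sumArrowLequivProdArrow (Idx r s) (Fin ν) ℝ ℝ)
  refine ⟨g, fun m => ?_⟩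
  have h1 : Q m = ∑ i, ((w i : SignType) : ℝ) * (e m i * e m i) := by
    rw [← e.map_app m, QuadraticMap.weightedSumSquares_apply]
    rfl
  have h2 : Q m = ∑ j, ((w' j : SignType) : ℝ) * (e m (σ.symm j) * e m (σ.symm j)) := by
    rw [h1, ← σ.sum_comp]
    simp [hσ]
  rw [h2, Fintype.sum_sum_type, Fintype.sum_sum_type, pqForm_apply]
  simp [w', g, LinearEquiv.sumArrowLequivProdArrow, sub_eq_add_neg, LinearMap.funLeft]

end Signature

/-! ### Witt frames -/

section Witt

/-- The model `(P × N) × (N* × R)` of a quadratic space with a distinguished subspace `P × N`, where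
`P` has signature `(r, s)`, where `N` is isotropic of dimension `ν` and in duality with `N*`, and
where `R` has signature `(p', q')`. -/
abbrev WittModel (r s ν p' q' : ℕ) : Type :=
  ((Idx r s → ℝ) × (Fin ν → ℝ)) × ((Fin ν → ℝ) × (Idx p' q' → ℝ))

/-- The symmetric form of the model `WittModel`, as a function. -/
noncomputable def wittForm {r s ν p' q' : ℕ} (u v : WittModel r s ν p' q') : ℝ :=
  pqForm r s u.1.1 v.1.1 + u.1.2 ⬝ᵥ v.2.1 + v.1.2 ⬝ᵥ u.2.1 + pqForm p' q' u.2.2 v.2.2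

/-- Coordinates on `ℝ^{p+q}` adapted to the subspace `W`: an isometry with a `WittModel` that takes
`W` to the summand `P × N`. -/
structure WittFrame (p q r s ν p' q' : ℕ) (W : Submodule ℝ (Idx p q → ℝ)) where
  /-- The coordinates. -/
  e : (Idx p q → ℝ) ≃ₗ[ℝ] WittModel r s ν p' q'
  form : ∀ v w, pqForm p q v w = wittForm (e v) (e w)
  mem_iff : ∀ v, v ∈ W ↔ (e v).2 = 0

/-- Polarization. -/
theorem bilin_ext_of_diag {M : Type*} [AddCommGroup M] [Module ℝ M]
    {B : LinearMap.BilinForm ℝ M} (hB : ∀ x y, B x y = B y x) {C : LinearMap.BilinForm ℝ M}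
    (hC : ∀ x y, C x y = C y x) (h : ∀ x, B x x = C x x) (x y : M) : B x y = C x y := by
  have h1 := h (x + y)
  simp only [map_add, LinearMap.add_apply] at h1
  linarith [h x, h y, hB x y, hC x y]

theorem wittForm_eq_zero {r s ν p' q' : ℕ} {u : WittModel r s ν p' q'}
    (h : ∀ v, wittForm u v = 0) : u = 0 := by
  obtain ⟨⟨x, n⟩, m, ρ⟩ := u
  have h1 : x = 0 := pqForm_eq_zero fun y => by simpa [wittForm] using h ((y, 0), (0, 0))
  have h2 : m = 0 := dotProduct_self_eq_zero.1 (by simpa [wittForm] using h ((0, m), (0, 0)))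
  have h3 : n = 0 := dotProduct_self_eq_zero.1 (by simpa [wittForm] using h ((0, 0), (n, 0)))
  have h4 : ρ = 0 := pqForm_eq_zero fun y => by simpa [wittForm] using h ((0, 0), (0, y))
  simp [h1, h2, h3, h4]

/-- An isotropic part of a subspace can be complemented by a dual isotropic subspace. -/
theorem exists_dual_isotropic {p q r s ν : ℕ}
    (j : (Idx r s → ℝ) × (Fin ν → ℝ) →ₗ[ℝ] (Idx p q → ℝ)) (hj : Function.Injective j)
    (hform : ∀ z z', pqForm p q (j z) (j z') = pqForm r s z.1 z'.1) :
    ∃ k : (Fin ν → ℝ) →ₗ[ℝ] (Idx p q → ℝ), (∀ m z, pqForm p q (k m) (j z) = z.2 ⬝ᵥ m) ∧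
      ∀ m m', pqForm p q (k m) (k m') = 0 := by
  have hb : Function.Surjective (pqForm p q) := by
    refine (LinearMap.injective_iff_surjective_of_finrank_eq_finrank
      (Subspace.dual_finrank_eq).symm).1 ?_
    rw [injective_iff_map_eq_zero]
    intro v hv
    exact pqForm_eq_zero fun y => by simp [hv]
  have hT : Function.Surjective (j.dualMap ∘ₗ pqForm p q) :=
    (LinearMap.dualMap_surjective_of_injective hj).comp hb
  obtain ⟨g, hg⟩ := LinearMap.exists_rightInverse_of_surjective _ (LinearMap.range_eq_top.2 hT)
  let d : (Fin ν → ℝ) →ₗ[ℝ] Module.Dual ℝ ((Idx r s → ℝ) × (Fin ν → ℝ)) :=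
    LinearMap.mk₂ ℝ (fun m z => z.2 ⬝ᵥ m) (by simp) (by simp) (by simp) (by simp)
  let k₀ := g ∘ₗ d
  have hk₀ : ∀ m z, pqForm p q (k₀ m) (j z) = z.2 ⬝ᵥ m := fun m z =>
    LinearMap.congr_fun (LinearMap.congr_fun hg (d m)) z
  -- Subtracting half of the Gram matrix of the first guess makes the complement isotropic.
  let c : (Fin ν → ℝ) →ₗ[ℝ] (Fin ν → ℝ) :=
    LinearMap.pi fun l => (1 / 2 : ℝ) • (pqForm p q (k₀ (Pi.single l 1)) ∘ₗ k₀)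
  have hc : ∀ m m', c m ⬝ᵥ m' = 1 / 2 * pqForm p q (k₀ m') (k₀ m) := by
    intro m m'
    have h1 : m' = ∑ l, m' l • Pi.single l 1 := by
      ext l
      simp [Finset.sum_apply, Pi.single_apply]
    conv_rhs => rw [h1, map_sum, map_sum, LinearMap.sum_apply, Finset.mul_sum]
    refine Finset.sum_congr rfl fun l _ => ?_
    simp only [c, LinearMap.pi_apply, LinearMap.smul_apply, LinearMap.comp_apply, map_smul,
      smul_eq_mul]
    ring
  refine ⟨k₀ - j ∘ₗ LinearMap.inr ℝ _ _ ∘ₗ c, fun m z => ?_, fun m m' => ?_⟩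
  · simp [hk₀, hform]
  · have h1 := hc m m'
    have h2 := hc m' m
    have h3 := pqForm_comm p q (j (0, c m)) (k₀ m')
    have h4 := pqForm_comm p q (k₀ m') (k₀ m)
    simp only [LinearMap.sub_apply, LinearMap.comp_apply, LinearMap.inr_apply, map_sub, hform, hk₀,
      h3, map_zero]
    linarith

/-- The pairs `(n, n)` and `(n, -n)` in `N × N*` contribute `ν` dimensions each to the positive and to
the negative part of `ℝ^{p+q}`, so `p` and `q` fix the signature of `R`. -/
theorem WittFrame.dim_eq {p q r s ν p' q' : ℕ} {W : Submodule ℝ (Idx p q → ℝ)}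
    (f : WittFrame p q r s ν p' q' W) : p = r + ν + p' ∧ q = s + ν + q' := by
  have h1 : Module.finrank ℝ (((Fin r → ℝ) × (Fin ν → ℝ)) × (Fin p' → ℝ)) ≤
      sigPos (Ipq p q).toQuadraticForm' := by
    refine finrank_le_sigPos (f.e.symm.toLinearMap ∘ₗ
      ((((pqInl r s ∘ₗ LinearMap.fst ℝ _ _).prod (LinearMap.snd ℝ _ _)) ∘ₗ
        LinearMap.fst ℝ _ _).prod ((LinearMap.snd ℝ _ _ ∘ₗ LinearMap.fst ℝ _ _).prod
          (pqInl p' q' ∘ₗ LinearMap.snd ℝ _ _)))) ?_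
    rintro ⟨⟨x, n⟩, y⟩ h
    simp only [toQuadraticForm'_Ipq_apply, f.form]
    rw [show wittForm _ _ = pqForm r s (pqInl r s x) (pqInl r s x) + n ⬝ᵥ (n) + n ⬝ᵥ (n) +
      pqForm p' q' (pqInl p' q' y) (pqInl p' q' y) by
        simp only [LinearMap.comp_apply, LinearEquiv.coe_coe, LinearEquiv.apply_symm_apply]
        rfl]
    simp only [pqForm_pqInl]
    by_contra! hle
    have hx : 0 ≤ x ⬝ᵥ x := Finset.sum_nonneg fun _ _ => mul_self_nonneg _
    have hn : 0 ≤ n ⬝ᵥ n := Finset.sum_nonneg fun _ _ => mul_self_nonneg _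
    have hy : 0 ≤ y ⬝ᵥ y := Finset.sum_nonneg fun _ _ => mul_self_nonneg _
    apply h
    rw [dotProduct_self_eq_zero.1 (show x ⬝ᵥ x = 0 by linarith),
      dotProduct_self_eq_zero.1 (show n ⬝ᵥ n = 0 by linarith),
      dotProduct_self_eq_zero.1 (show y ⬝ᵥ y = 0 by linarith)]
    rfl
  have h2 : Module.finrank ℝ (((Fin s → ℝ) × (Fin ν → ℝ)) × (Fin q' → ℝ)) ≤
      sigNeg (Ipq p q).toQuadraticForm' := by
    refine finrank_le_sigNeg (f.e.symm.toLinearMap ∘ₗ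
      ((((pqInr r s ∘ₗ LinearMap.fst ℝ _ _).prod (LinearMap.snd ℝ _ _)) ∘ₗ
        LinearMap.fst ℝ _ _).prod ((-LinearMap.snd ℝ _ _ ∘ₗ LinearMap.fst ℝ _ _).prod
          (pqInr p' q' ∘ₗ LinearMap.snd ℝ _ _)))) ?_
    rintro ⟨⟨x, n⟩, y⟩ h
    simp only [toQuadraticForm'_Ipq_apply, f.form]
    rw [show wittForm _ _ = pqForm r s (pqInr r s x) (pqInr r s x) + n ⬝ᵥ (-n) + n ⬝ᵥ (-n) +
      pqForm p' q' (pqInr p' q' y) (pqInr p' q' y) by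
        simp only [LinearMap.comp_apply, LinearEquiv.coe_coe, LinearEquiv.apply_symm_apply]
        rfl]
    simp only [pqForm_pqInr, dotProduct_neg]
    by_contra! hle
    have hx : 0 ≤ x ⬝ᵥ x := Finset.sum_nonneg fun _ _ => mul_self_nonneg _
    have hn : 0 ≤ n ⬝ᵥ n := Finset.sum_nonneg fun _ _ => mul_self_nonneg _
    have hy : 0 ≤ y ⬝ᵥ y := Finset.sum_nonneg fun _ _ => mul_self_nonneg _
    apply h
    rw [dotProduct_self_eq_zero.1 (show x ⬝ᵥ x = 0 by linarith),
      dotProduct_self_eq_zero.1 (show n ⬝ᵥ n = 0 by linarith),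
      dotProduct_self_eq_zero.1 (show y ⬝ᵥ y = 0 by linarith)]
    rfl
  have h3 := f.e.finrank_eq
  rw [(hasSignature_pqForm p q).1] at h1
  rw [(hasSignature_pqForm p q).2] at h2
  simp at h1 h2 h3
  omega

/-- Every subspace of signature `(r, s)` has a Witt frame. -/
theorem exists_wittFrame {p q r s ν : ℕ} {W : Submodule ℝ (Idx p q → ℝ)}
    (hW : HasSignature ((Ipq p q).toQuadraticForm'.restrict W) r s)
    (hν : Module.finrank ℝ W = r + s + ν) :
    ∃ p' q', Nonempty (WittFrame p q r s ν p' q' W) := by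
  obtain ⟨f, hf⟩ := exists_equiv_pqForm hW hν
  let j := W.subtype ∘ₗ f.symm.toLinearMap
  have hj : Function.Injective j := W.subtype_injective.comp f.symm.injective
  have hform : ∀ z z', pqForm p q (j z) (j z') = pqForm r s z.1 z'.1 :=
    bilin_ext_of_diag (B := (pqForm p q).compl₁₂ j j)
      (C := (pqForm r s).compl₁₂ (LinearMap.fst ℝ _ _) (LinearMap.fst ℝ _ _))
      (fun _ _ => pqForm_comm _ _ _ _) (fun _ _ => pqForm_comm _ _ _ _) fun z => by
        simpa using! hf (f.symm z)
  obtain ⟨k, hkj, hkk⟩ := exists_dual_isotropic j hj hform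
  let ι : ((Idx r s → ℝ) × (Fin ν → ℝ)) × (Fin ν → ℝ) →ₗ[ℝ] (Idx p q → ℝ) := j.coprod k
  have hι : ∀ u v, pqForm p q (ι u) (ι v) =
      pqForm r s u.1.1 v.1.1 + u.1.2 ⬝ᵥ v.2 + v.1.2 ⬝ᵥ u.2 := by
    intro u v
    simp [ι, hform, hkj, hkk, pqForm_comm p q (j u.1) (k v.2)]
  set H := LinearMap.range ι with hH
  set R := (pqForm p q).orthogonal H with hR
  have hrefl : (pqForm p q).IsRefl := fun x y h => by rw [pqForm_comm, h]
  have hcompl : IsCompl H R := by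
    rw [LinearMap.BilinForm.isCompl_orthogonal_iff_disjoint hrefl, Submodule.disjoint_def]
    rintro _ ⟨u, rfl⟩ hu
    have h0 : ((u.1, (u.2, 0)) : WittModel r s ν 0 0) = 0 := wittForm_eq_zero fun v => by
      have h1 := hu (ι (v.1, v.2.1)) ⟨_, rfl⟩
      change pqForm p q _ _ = 0 at h1
      rw [pqForm_comm, hι] at h1
      simpa [wittForm] using h1
    have h1 : u.1 = 0 := congrArg Prod.fst h0
    have h2 : u.2 = 0 := congrArg (fun z => z.2.1) h0
    rw [show u = 0 from Prod.ext h1 h2, map_zero]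
  have hHR : ∀ u v, v ∈ R → pqForm p q (ι u) v = 0 := fun u v hv => hv _ ⟨u, rfl⟩
  obtain ⟨ν', hν'⟩ : ∃ ν', ν' = Module.finrank ℝ
    ((Ipq p q).toQuadraticForm'.restrict R).radical := ⟨_, rfl⟩
  obtain ⟨g, hg⟩ := exists_equiv_pqForm (Q := (Ipq p q).toQuadraticForm'.restrict R) ⟨rfl, rfl⟩
    (hν' ▸ QuadraticForm.sigPos_add_sigNeg_add_radical.symm)
  generalize sigPos ((Ipq p q).toQuadraticForm'.restrict R) = p' at g hg
  generalize sigNeg ((Ipq p q).toQuadraticForm'.restrict R) = q' at g hg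
  have hgform : ∀ z z' : R, pqForm p q z z' = pqForm p' q' (g z).1 (g z').1 :=
    bilin_ext_of_diag (B := (pqForm p q).compl₁₂ R.subtype R.subtype)
      (C := (pqForm p' q').compl₁₂ (LinearMap.fst ℝ _ _ ∘ₗ g.toLinearMap)
        (LinearMap.fst ℝ _ _ ∘ₗ g.toLinearMap))
      (fun _ _ => pqForm_comm _ _ _ _) (fun _ _ => pqForm_comm _ _ _ _) hg
  -- The radical of `R = H^⊥` vanishes, since it is orthogonal to `H + R`, the whole space.
  have hν0 : ν' = 0 := by
    by_contra h0
    let τ : Fin ν' → ℝ := fun _ => 1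
    have h1 : ((g.symm (0, τ) : R) : Idx p q → ℝ) = 0 := by
      refine pqForm_eq_zero fun y => ?_
      obtain ⟨_, ⟨u, rfl⟩, z, hz, rfl⟩ := Submodule.mem_sup.1
        (hcompl.sup_eq_top ▸ Submodule.mem_top : y ∈ H ⊔ R)
      rw [map_add, pqForm_comm, hHR u _ (g.symm (0, τ)).2, hgform _ ⟨z, hz⟩]
      simp
    have h2 : ((0, τ) : (Idx p' q' → ℝ) × (Fin ν' → ℝ)) = 0 := by
      simpa using h1
    have h3 := congrFun (congrArg Prod.snd h2) ⟨0, Nat.pos_of_ne_zero h0⟩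
    simp [τ] at h3
  clear hν'
  subst hν0
  let Φ : WittModel r s ν p' q' →ₗ[ℝ] (Idx p q → ℝ) :=
    ι ∘ₗ ((LinearMap.fst ℝ _ _).prod (LinearMap.fst ℝ _ _ ∘ₗ LinearMap.snd ℝ _ _)) +
      R.subtype ∘ₗ g.symm.toLinearMap ∘ₗ LinearMap.inl ℝ _ _ ∘ₗ LinearMap.snd ℝ _ _ ∘ₗ
        LinearMap.snd ℝ _ _
  have hΦ : ∀ u, Φ u = ι (u.1, u.2.1) + g.symm (u.2.2, 0) := fun u => rfl
  have hΦform : ∀ u v, pqForm p q (Φ u) (Φ v) = wittForm u v := by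
    intro u v
    have h1 := hHR (u.1, u.2.1) _ (g.symm (v.2.2, 0)).2
    have h2 := hHR (v.1, v.2.1) _ (g.symm (u.2.2, 0)).2
    rw [pqForm_comm] at h2
    simp only [hΦ, map_add, LinearMap.add_apply, hι, h1, h2, hgform, wittForm,
      LinearEquiv.apply_symm_apply]
    ring
  have hinj : Function.Injective Φ := by
    rw [injective_iff_map_eq_zero]
    intro u hu
    refine wittForm_eq_zero fun v => ?_
    rw [← hΦform, hu]
    simp
  have hsurj : Function.Surjective Φ := by
    intro y
    obtain ⟨_, ⟨u, rfl⟩, z, hz, rfl⟩ := Submodule.mem_sup.1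
      (hcompl.sup_eq_top ▸ Submodule.mem_top : y ∈ H ⊔ R)
    refine ⟨(u.1, (u.2, (g ⟨z, hz⟩).1)), ?_⟩
    have h1 : ((g ⟨z, hz⟩).1, (0 : Fin 0 → ℝ)) = g ⟨z, hz⟩ :=
      Prod.ext rfl (Subsingleton.elim _ _)
    rw [hΦ]
    simp only [h1, LinearEquiv.symm_apply_apply]
  let e := (LinearEquiv.ofBijective Φ ⟨hinj, hsurj⟩).symm
  have he : ∀ v, Φ (e v) = v := fun v => (LinearEquiv.ofBijective Φ ⟨hinj, hsurj⟩).apply_symm_apply v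
  refine ⟨p', q', ⟨e, fun v w => by rw [← hΦform, he, he], fun v => ?_⟩⟩
  have hΦj : ∀ z, Φ (z, 0) = j z := fun z => by simp [hΦ, ι]
  constructor
  · intro hv
    have h1 : Φ (f ⟨v, hv⟩, 0) = v := by
      rw [hΦj]
      simp [j]
    rw [← hinj (h1.trans (he v).symm)]
  · intro hv
    have h1 : e v = ((e v).1, 0) := Prod.ext rfl hv
    rw [← he v, h1, hΦj]
    exact (f.symm _).2

end Witt

/-! ### Orbits of `SO(p,q)` on the Grassmannian -/

section Orbits

variable {p q : ℕ}

theorem transpose_mul_Ipq_mul_iff (M : Matrix (Idx p q) (Idx p q) ℝ) :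
    M.transpose * Ipq p q * M = Ipq p q ↔
      ∀ v w, pqForm p q (M.toLin' v) (M.toLin' w) = pqForm p q v w := by
  have h : LinearMap.toMatrix₂' ℝ ((pqForm p q).compl₁₂ M.toLin' M.toLin') =
      M.transpose * Ipq p q * M := by
    rw [LinearMap.toMatrix₂'_compl₁₂, LinearMap.toMatrix'_toLin', pqForm,
      LinearMap.toMatrix'_toLinearMap₂']
  have h' : LinearMap.toMatrix₂' ℝ (pqForm p q) = Ipq p q := by
    rw [pqForm, LinearMap.toMatrix'_toLinearMap₂']
  constructor
  · intro hM v w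
    have h1 : (pqForm p q).compl₁₂ M.toLin' M.toLin' = pqForm p q :=
      (LinearMap.toMatrix₂' ℝ).injective (by rw [h, h', hM])
    exact LinearMap.congr_fun₂ h1 v w
  · intro hM
    rw [← h, ← h']
    exact congrArg _ (LinearMap.ext₂ hM)

theorem det_isometry_sq {g : (Idx p q → ℝ) →ₗ[ℝ] (Idx p q → ℝ)}
    (hg : ∀ v w, pqForm p q (g v) (g w) = pqForm p q v w) :
    LinearMap.det g * LinearMap.det g = 1 := by
  have h := (transpose_mul_Ipq_mul_iff g.toMatrix').2 (by simpa using hg)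
  have h1 := congrArg Matrix.det h
  rw [Matrix.det_mul, Matrix.det_mul, Matrix.det_transpose, LinearMap.det_toMatrix'] at h1
  have h2 : (Ipq p q).det ≠ 0 := by
    rw [Ipq, LieAlgebra.Orthogonal.indefiniteDiagonal, Matrix.det_diagonal, Finset.prod_ne_zero_iff]
    rintro (j | j) _ <;> simp
  apply mul_right_cancel₀ h2
  linarith

/-- Isometries of determinant `1` move subspaces inside their `SO(p,q)`-orbits. -/
theorem mem_orbit_of_isometry {i : ℕ} {x y : Gr (Idx p q → ℝ) i}
    (g : (Idx p q → ℝ) →ₗ[ℝ] (Idx p q → ℝ))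
    (hg : ∀ v w, pqForm p q (g v) (g w) = pqForm p q v w) (hdet : LinearMap.det g = 1)
    (hxy : ∀ v ∈ x.1, g v ∈ y.1) : y ∈ MulAction.orbit (SO p q) x := by
  let A : SO p q := ⟨⟨g.toMatrix', by rw [LinearMap.det_toMatrix', hdet]⟩,
    (transpose_mul_Ipq_mul_iff g.toMatrix').2 (by simpa using hg)⟩
  refine ⟨A, Subtype.ext ?_⟩
  refine Submodule.eq_of_le_of_finrank_eq ?_ ((A • x).2.trans y.2.symm)
  rintro _ ⟨v, hv, rfl⟩
  have h : Matrix.SpecialLinearGroup.toLin' A.1 v = g v := by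
    rw [Matrix.SpecialLinearGroup.toLin'_apply]
    simp [A]
  exact (congrArg (· ∈ y.1) h).mpr (hxy v hv)

theorem orbit_subset_orbitOfType {i r s : ℕ} {x : Gr (Idx p q → ℝ) i}
    (hx : x ∈ orbitOfType p q i r s) : MulAction.orbit (SO p q) x ⊆ orbitOfType p q i r s := by
  rintro _ ⟨A, rfl⟩
  have hA := (transpose_mul_Ipq_mul_iff A.1.1).1 A.2
  refine (HasSignature.congr ⟨{
    (Matrix.SpecialLinearGroup.toLin' A.1).submoduleMap x.1 with
    map_app' := fun v => ?_ }⟩ r s).1 hx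
  exact hA v.1 v.1

/-- The reflection in a vector that is not isotropic is an isometry of determinant `-1`. -/
theorem exists_reflection {u : Idx p q → ℝ} (hu : pqForm p q u u ≠ 0) :
    ∃ ρ : (Idx p q → ℝ) →ₗ[ℝ] (Idx p q → ℝ),
      (∀ v w, pqForm p q (ρ v) (ρ w) = pqForm p q v w) ∧ LinearMap.det ρ = -1 ∧
      ∀ v, ρ v = v - (2 / pqForm p q u u * pqForm p q u v) • u := by
  refine ⟨LinearMap.transvection (-(2 / pqForm p q u u) • pqForm p q u) u, fun v w => ?_, ?_,
    fun v => ?_⟩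
  · simp only [LinearMap.transvection.apply, map_add, map_smul, LinearMap.add_apply,
      LinearMap.smul_apply, smul_eq_mul, pqForm_comm p q v u]
    field_simp
    ring
  · rw [LinearMap.transvection.det, LinearMap.smul_apply, smul_eq_mul]
    field_simp
    ring
  · simp [LinearMap.transvection.apply, sub_eq_add_neg]

variable {r s ν p' q' : ℕ}

/-- If `P` or `R` is nonzero, there is a vector that is not isotropic and whose reflection preserves
`W`: it lies in `P ⊆ W` or in `R`, which is orthogonal to `W`. -/
theorem WittFrame.exists_reflecting_vector {W : Submodule ℝ (Idx p q → ℝ)}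
    (F : WittFrame p q r s ν p' q' W) (h : r ≠ 0 ∨ s ≠ 0 ∨ p' ≠ 0 ∨ q' ≠ 0) :
    ∃ u, pqForm p q u u ≠ 0 ∧ (u ∈ W ∨ ∀ v ∈ W, pqForm p q u v = 0) := by
  have hP : ∀ x : Idx r s → ℝ, pqForm r s x x ≠ 0 →
      ∃ u, pqForm p q u u ≠ 0 ∧ (u ∈ W ∨ ∀ v ∈ W, pqForm p q u v = 0) := fun x hx =>
    ⟨F.e.symm ((x, 0), 0), by simpa [F.form, wittForm] using hx, .inl (by simp [F.mem_iff])⟩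
  have hR : ∀ y : Idx p' q' → ℝ, pqForm p' q' y y ≠ 0 →
      ∃ u, pqForm p q u u ≠ 0 ∧ (u ∈ W ∨ ∀ v ∈ W, pqForm p q u v = 0) := fun y hy =>
    ⟨F.e.symm (0, (0, y)), by simpa [F.form, wittForm] using hy, .inr fun v hv => by
      simp [F.form, wittForm, (F.mem_iff v).1 hv]⟩
  have h1 : ∀ n : ℕ, n ≠ 0 → ((fun _ => 1 : Fin n → ℝ) ⬝ᵥ fun _ => 1) ≠ 0 := by
    intro n hn
    simp [dotProduct, hn]
  rcases h with h | h | h | h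
  · exact hP (pqInl r s fun _ => 1) (by rw [pqForm_pqInl]; exact h1 _ h)
  · exact hP (pqInr r s fun _ => 1) (by rw [pqForm_pqInr]; exact neg_ne_zero.2 (h1 _ h))
  · exact hR (pqInl p' q' fun _ => 1) (by rw [pqForm_pqInl]; exact h1 _ h)
  · exact hR (pqInr p' q' fun _ => 1) (by rw [pqForm_pqInr]; exact neg_ne_zero.2 (h1 _ h))

/-- **Witt's theorem** for `SO(p,q)`, from the Witt frames of the two subspaces: composing with a
reflection corrects the determinant. -/
theorem WittFrame.mem_orbit {i : ℕ} {x y : Gr (Idx p q → ℝ) i}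
    (F : WittFrame p q r s ν p' q' x.1) (G : WittFrame p q r s ν p' q' y.1)
    (h : (r ≠ 0 ∨ s ≠ 0 ∨ p' ≠ 0 ∨ q' ≠ 0) ∨ (p = 0 ∧ q = 0)) :
    y ∈ MulAction.orbit (SO p q) x := by
  let g : (Idx p q → ℝ) →ₗ[ℝ] (Idx p q → ℝ) := G.e.symm.toLinearMap ∘ₗ F.e.toLinearMap
  have hg : ∀ v w, pqForm p q (g v) (g w) = pqForm p q v w := fun v w => by
    rw [F.form v w, G.form (g v) (g w)]
    simp [g]
  have hgxy : ∀ v ∈ x.1, g v ∈ y.1 := fun v hv => by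
    simpa [g, G.mem_iff] using (F.mem_iff v).1 hv
  rcases h with h | ⟨rfl, rfl⟩
  · rcases mul_self_eq_one_iff.1 (det_isometry_sq hg) with h1 | h1
    · exact mem_orbit_of_isometry g hg h1 hgxy
    · obtain ⟨u, hu, hu'⟩ := F.exists_reflecting_vector h
      obtain ⟨ρ, hρ, hdet, hρ'⟩ := exists_reflection hu
      refine mem_orbit_of_isometry (g ∘ₗ ρ) (fun v w => by simp [hg, hρ])
        (by rw [LinearMap.det_comp, h1, hdet]; norm_num) fun v hv => hgxy _ ?_
      rw [hρ']
      rcases hu' with hu' | hu'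
      · exact x.1.sub_mem hv (x.1.smul_mem _ hu')
      · simpa [hu' v hv] using hv
  · exact mem_orbit_of_isometry g hg (LinearMap.det_eq_one_of_subsingleton _) hgxy

theorem exists_wittFrame_of_mem {i r s : ℕ} {x : Gr (Idx p q → ℝ) i}
    (hx : x ∈ orbitOfType p q i r s) : i = r + s + (i - r - s) ∧
      ∃ p' q', Nonempty (WittFrame p q r s (i - r - s) p' q' x.1) := by
  have h1 := QuadraticForm.sigPos_add_sigNeg_add_radical
    (Q := (Ipq p q).toQuadraticForm'.restrict x.1)
  obtain ⟨h2, h3⟩ := id hx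
  have h4 : i = r + s + (i - r - s) := by
    have := x.2
    omega
  exact ⟨h4, exists_wittFrame hx (x.2.trans h4)⟩

/-- Outside the exceptional case, the subspaces of a given signature form a single orbit. -/
theorem mem_orbit_of_mem_orbitOfType {i r s : ℕ} {x y : Gr (Idx p q → ℝ) i}
    (hx : x ∈ orbitOfType p q i r s) (hy : y ∈ orbitOfType p q i r s)
    (h : ¬ (0 < p ∧ p = q ∧ i = p ∧ r = 0 ∧ s = 0)) : y ∈ MulAction.orbit (SO p q) x := by
  obtain ⟨hi, p₁, q₁, ⟨F⟩⟩ := exists_wittFrame_of_mem hx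
  obtain ⟨-, p₂, q₂, ⟨G⟩⟩ := exists_wittFrame_of_mem hy
  have hF := F.dim_eq
  have hG := G.dim_eq
  obtain rfl : p₂ = p₁ := by omega
  obtain rfl : q₂ = q₁ := by omega
  -- If `r`, `s`, `p₁`, `q₁` all vanish, then `p = q = ν = i`, and the exception leaves `p = q = 0`.
  exact F.mem_orbit G (by omega)

/-- A totally isotropic subspace that is the graph of a linear map over a Lagrangian subspace `x`
lies in the `SO(p,q)`-orbit of `x`: the unipotent shear along the map is an isometry, and it is the
square of an isometry. -/
theorem WittFrame.mem_orbit_of_graph {i : ℕ} {x y : Gr (Idx p q → ℝ) i}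
    (F : WittFrame p q 0 0 ν 0 0 x.1)
    (A : ((Idx 0 0 → ℝ) × (Fin ν → ℝ)) →ₗ[ℝ] (Fin ν → ℝ) × (Idx 0 0 → ℝ))
    (hA : ∀ v, v ∈ y.1 ↔ (F.e v).2 = A (F.e v).1)
    (hy : HasSignature ((Ipq p q).toQuadraticForm'.restrict y.1) 0 0) :
    y ∈ MulAction.orbit (SO p q) x := by
  have h0 : ∀ v w : Idx 0 0 → ℝ, pqForm 0 0 v w = 0 := fun v w => by simp [pqForm_apply]
  obtain ⟨f, hf⟩ := exists_equiv_pqForm (ν := Module.finrank ℝ y.1) hy (by simp)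
  have hiso : ∀ v w : y.1, pqForm p q v w = 0 := by
    intro v w
    exact bilin_ext_of_diag (B := (pqForm p q).compl₁₂ y.1.subtype y.1.subtype)
      (C := 0) (fun _ _ => pqForm_comm _ _ _ _) (fun _ _ => rfl)
      (fun v => (hf v).trans (h0 _ _)) v w
  have hAA : ∀ z w, z.2 ⬝ᵥ (A w).1 + w.2 ⬝ᵥ (A z).1 = 0 := by
    intro z w
    have h1 := hiso ⟨F.e.symm (z, A z), by simp [hA]⟩ ⟨F.e.symm (w, A w), by simp [hA]⟩
    simpa [F.form, wittForm, h0] using h1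
  let k : (Idx p q → ℝ) →ₗ[ℝ] (Idx p q → ℝ) := LinearMap.id + F.e.symm.toLinearMap ∘ₗ
    LinearMap.inr ℝ _ _ ∘ₗ ((1 / 2 : ℝ) • A) ∘ₗ LinearMap.fst ℝ _ _ ∘ₗ F.e.toLinearMap
  have hk : ∀ v, F.e (k v) = ((F.e v).1, (F.e v).2 + (1 / 2 : ℝ) • A (F.e v).1) := by
    intro v
    simp only [k, LinearMap.add_apply, LinearMap.id_apply, map_add, LinearMap.comp_apply,
      LinearEquiv.coe_coe, LinearEquiv.apply_symm_apply]
    ext <;> simp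
  have hkform : ∀ v w, pqForm p q (k v) (k w) = pqForm p q v w := by
    intro v w
    simp only [F.form, wittForm, hk, h0, Prod.fst_add, Prod.smul_fst, dotProduct_add,
      dotProduct_smul, smul_eq_mul]
    linarith [hAA (F.e v).1 (F.e w).1]
  refine mem_orbit_of_isometry (k ∘ₗ k) (fun v w => by simp [hkform])
    (by rw [LinearMap.det_comp, det_isometry_sq hkform]) fun v hv => ?_
  rw [hA, LinearMap.comp_apply, hk, hk, (F.mem_iff v).1 hv]
  simp only [zero_add, ← add_smul]
  norm_num

end Orbits

/-! ### Gram forms of graphs and their Schur complements -/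

section Schur

variable {r s ν p' q' : ℕ}

/-- The model space of the affine chart of the Grassmannian in a Witt frame. -/
abbrev GraphModel (r s ν p' q' : ℕ) : Type :=
  ((Idx r s → ℝ) × (Fin ν → ℝ)) →L[ℝ] ((Fin ν → ℝ) × (Idx p' q' → ℝ))

/-- The form `wittForm` as a continuous bilinear map. -/
noncomputable def wittCLM (r s ν p' q' : ℕ) :
    WittModel r s ν p' q' →L[ℝ] WittModel r s ν p' q' →L[ℝ] ℝ :=
  LinearMap.toContinuousBilinearMap (LinearMap.mk₂ ℝ wittForm
    (fun u u' v => by simp [wittForm]; ring) (fun c u v => by simp [wittForm]; ring)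
    (fun u v v' => by simp [wittForm]; ring) (fun c u v => by simp [wittForm]; ring))

theorem wittCLM_apply (u v : WittModel r s ν p' q') : wittCLM r s ν p' q' u v = wittForm u v := rfl

theorem wittForm_comm (u v : WittModel r s ν p' q') : wittForm u v = wittForm v u := by
  rw [wittForm, wittForm, pqForm_comm r s, pqForm_comm p' q']
  ring

/-- The pullback of a continuous bilinear form along a pair of continuous linear maps, in a shape
for which smoothness in all arguments is immediate. -/
noncomputable def pullbackForm {X Y V W : Type*} [NormedAddCommGroup X] [NormedSpace ℝ X]
    [NormedAddCommGroup Y] [NormedSpace ℝ Y] [NormedAddCommGroup V] [NormedSpace ℝ V]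
    [NormedAddCommGroup W] [NormedSpace ℝ W]
    (B : V →L[ℝ] W →L[ℝ] ℝ) (f : X →L[ℝ] V) (g : Y →L[ℝ] W) : X →L[ℝ] Y →L[ℝ] ℝ :=
  ((ContinuousLinearMap.compL ℝ Y W ℝ).flip g).comp (B.comp f)

theorem pullbackForm_apply {X Y V W : Type*} [NormedAddCommGroup X] [NormedSpace ℝ X]
    [NormedAddCommGroup Y] [NormedSpace ℝ Y] [NormedAddCommGroup V] [NormedSpace ℝ V]
    [NormedAddCommGroup W] [NormedSpace ℝ W]
    (B : V →L[ℝ] W →L[ℝ] ℝ) (f : X →L[ℝ] V) (g : Y →L[ℝ] W) (x : X) (y : Y) :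
    pullbackForm B f g x y = B (f x) (g y) := rfl

theorem ContDiff.pullbackForm {E X Y V W : Type*} [NormedAddCommGroup E] [NormedSpace ℝ E]
    [NormedAddCommGroup X] [NormedSpace ℝ X]
    [NormedAddCommGroup Y] [NormedSpace ℝ Y] [NormedAddCommGroup V] [NormedSpace ℝ V]
    [NormedAddCommGroup W] [NormedSpace ℝ W] {n : ℕ∞ω}
    {B : E → V →L[ℝ] W →L[ℝ] ℝ} {f : E → X →L[ℝ] V} {g : E → Y →L[ℝ] W}
    (hB : ContDiff ℝ n B) (hf : ContDiff ℝ n f) (hg : ContDiff ℝ n g) :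
    ContDiff ℝ n fun a => _root_.pullbackForm (B a) (f a) (g a) := by
  have h : ContDiff ℝ n fun a => (ContinuousLinearMap.compL ℝ Y W ℝ).flip (g a) :=
    (ContinuousLinearMap.contDiff _).comp hg
  exact h.clm_comp (hB.clm_comp hf)

/-- The Gram form of the graph of `A`, on the domain of `A`. -/
noncomputable def gram (A : GraphModel r s ν p' q') :
    ((Idx r s → ℝ) × (Fin ν → ℝ)) →L[ℝ] ((Idx r s → ℝ) × (Fin ν → ℝ)) →L[ℝ] ℝ :=
  pullbackForm (wittCLM r s ν p' q')
    (ContinuousLinearMap.inl ℝ _ _ + (ContinuousLinearMap.inr ℝ _ _).comp A)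
    (ContinuousLinearMap.inl ℝ _ _ + (ContinuousLinearMap.inr ℝ _ _).comp A)

theorem gram_apply (A : GraphModel r s ν p' q') (z w : (Idx r s → ℝ) × (Fin ν → ℝ)) :
    gram A z w = wittForm (z, A z) (w, A w) := by
  rw [gram, pullbackForm_apply, wittCLM_apply]
  simp

theorem gram_comm (A : GraphModel r s ν p' q') (z w : (Idx r s → ℝ) × (Fin ν → ℝ)) :
    gram A z w = gram A w z := by
  rw [gram_apply, gram_apply, wittForm_comm]

theorem contDiff_gram : ContDiff ℝ ∞ (gram : GraphModel r s ν p' q' → _) := by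
  have h : ContDiff ℝ ∞ fun A : GraphModel r s ν p' q' =>
      ContinuousLinearMap.inl ℝ ((Idx r s → ℝ) × (Fin ν → ℝ)) ((Fin ν → ℝ) × (Idx p' q' → ℝ)) +
        (ContinuousLinearMap.inr ℝ _ _).comp A :=
    contDiff_const.add (contDiff_const.clm_comp contDiff_id)
  exact ContDiff.pullbackForm contDiff_const h h

/-- The block of the Gram form on the nondegenerate summand `P`. -/
noncomputable def gramPP (A : GraphModel r s ν p' q') :
    (Idx r s → ℝ) →L[ℝ] (Idx r s → ℝ) →L[ℝ] ℝ :=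
  pullbackForm (gram A) (ContinuousLinearMap.inl ℝ _ _) (ContinuousLinearMap.inl ℝ _ _)

/-- The block of the Gram form that pairs the radical `N` with `P`. -/
noncomputable def gramNP (A : GraphModel r s ν p' q') :
    (Fin ν → ℝ) →L[ℝ] (Idx r s → ℝ) →L[ℝ] ℝ :=
  pullbackForm (gram A) (ContinuousLinearMap.inr ℝ _ _) (ContinuousLinearMap.inl ℝ _ _)

theorem gramPP_apply (A : GraphModel r s ν p' q') (x y : Idx r s → ℝ) :
    gramPP A x y = gram A (x, 0) (y, 0) := rfl

theorem gramNP_apply (A : GraphModel r s ν p' q') (n : Fin ν → ℝ) (y : Idx r s → ℝ) :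
    gramNP A n y = gram A (0, n) (y, 0) := rfl

theorem contDiff_gramPP : ContDiff ℝ ∞ (gramPP : GraphModel r s ν p' q' → _) :=
  ContDiff.pullbackForm contDiff_gram contDiff_const contDiff_const

theorem contDiff_gramNP : ContDiff ℝ ∞ (gramNP : GraphModel r s ν p' q' → _) :=
  ContDiff.pullbackForm contDiff_gram contDiff_const contDiff_const

/-- The standard form `pqForm` as a continuous bilinear map. -/
noncomputable def pqCLM (r s : ℕ) : (Idx r s → ℝ) →L[ℝ] (Idx r s → ℝ) →L[ℝ] ℝ :=
  LinearMap.toContinuousBilinearMap (pqForm r s)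

theorem pqCLM_apply (r s : ℕ) (x y : Idx r s → ℝ) : pqCLM r s x y = pqForm r s x y := rfl

/-- The graphs whose Gram form on `P` has distance less than `1` from the standard form of signature
`(r, s)`; by `norm_sq_le_sum_sq` this is close enough to keep it nondegenerate of that signature. -/
def schurDomain (r s ν p' q' : ℕ) : Set (GraphModel r s ν p' q') :=
  gramPP ⁻¹' Metric.ball (pqCLM r s) 1

theorem isOpen_schurDomain : IsOpen (schurDomain r s ν p' q') :=
  Metric.isOpen_ball.preimage contDiff_gramPP.continuous

theorem abs_gramPP_sub_lt {A : GraphModel r s ν p' q'} (hA : A ∈ schurDomain r s ν p' q')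
    {x : Idx r s → ℝ} (hx : x ≠ 0) : |gramPP A x x - pqForm r s x x| < ∑ j, x j ^ 2 := by
  have h1 : |gramPP A x x - pqForm r s x x| ≤ ‖gramPP A - pqCLM r s‖ * ‖x‖ * ‖x‖ :=
    (gramPP A - pqCLM r s).le_opNorm₂ x x
  have h2 : 0 < ‖x‖ := norm_pos_iff.2 hx
  have h3 : ‖gramPP A - pqCLM r s‖ < 1 :=
    (dist_eq_norm (gramPP A) (pqCLM r s)).symm.trans_lt hA
  calc |gramPP A x x - pqForm r s x x| ≤ ‖gramPP A - pqCLM r s‖ * ‖x‖ * ‖x‖ := h1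
    _ = ‖gramPP A - pqCLM r s‖ * ‖x‖ ^ 2 := by ring
    _ < 1 * ‖x‖ ^ 2 := mul_lt_mul_of_pos_right h3 (by positivity)
    _ ≤ _ := by rw [one_mul]; exact norm_sq_le_sum_sq r s x

/-- The quadratic form of a continuous bilinear form. -/
noncomputable def clmQuadratic {X : Type*} [NormedAddCommGroup X] [NormedSpace ℝ X]
    (B : X →L[ℝ] X →L[ℝ] ℝ) : QuadraticForm ℝ X :=
  LinearMap.BilinMap.toQuadraticMap (ContinuousLinearMap.coeLM ℝ ∘ₗ B.toLinearMap)

theorem clmQuadratic_apply {X : Type*} [NormedAddCommGroup X] [NormedSpace ℝ X]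
    (B : X →L[ℝ] X →L[ℝ] ℝ) (x : X) : clmQuadratic B x = B x x := rfl

theorem hasSignature_gramPP {A : GraphModel r s ν p' q'} (hA : A ∈ schurDomain r s ν p' q') :
    HasSignature (clmQuadratic (gramPP A)) r s ∧
      Module.finrank ℝ (clmQuadratic (gramPP A)).radical = 0 := by
  have h := hasSignature_of_posDef_of_negDef (Q := clmQuadratic (gramPP A))
    (pqInl r s) (fun x hx => ?_) (pqInr r s) (fun x hx => ?_) (by simp)
  · simpa using h
  · have h1 : pqInl r s x ≠ 0 := fun h => (dotProduct_self_pos hx).ne'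
      (by rw [← pqForm_pqInl r s, h]; simp)
    have h2 := abs_gramPP_sub_lt hA h1
    have h3 : ∑ j, pqInl r s x j ^ 2 = x ⬝ᵥ x := by simp [pqInl, dotProduct, sq]
    rw [h3, pqForm_pqInl] at h2
    rw [clmQuadratic_apply]
    linarith [(abs_lt.1 h2).1]
  · have h1 : pqInr r s x ≠ 0 := fun h => (dotProduct_self_pos hx).ne'
      (by rw [← neg_eq_zero, ← pqForm_pqInr r s, h]; simp)
    have h2 := abs_gramPP_sub_lt hA h1
    have h3 : ∑ j, pqInr r s x j ^ 2 = x ⬝ᵥ x := by simp [pqInr, dotProduct, sq]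
    rw [h3, pqForm_pqInr] at h2
    rw [clmQuadratic_apply]
    linarith [(abs_lt.1 h2).2]

theorem exists_equiv_gramPP {A : GraphModel r s ν p' q'} (hA : A ∈ schurDomain r s ν p' q') :
    ∃ e : (Idx r s → ℝ) ≃L[ℝ] ((Idx r s → ℝ) →L[ℝ] ℝ),
      (e : (Idx r s → ℝ) →L[ℝ] (Idx r s → ℝ) →L[ℝ] ℝ) = gramPP A := by
  have hinj : Function.Injective (gramPP A).toLinearMap := by
    rw [injective_iff_map_eq_zero]
    intro x hx
    have h1 : ∀ y, gramPP A x y = 0 := fun y => DFunLike.congr_fun hx y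
    have h2 : ∀ y, gramPP A y x = 0 := fun y => by
      rw [gramPP_apply, gram_comm, ← gramPP_apply, h1]
    have h3 : x ∈ (clmQuadratic (gramPP A)).radical := by
      rw [QuadraticMap.mem_radical_iff']
      refine ⟨h1 x, fun y => ?_⟩
      simp only [clmQuadratic_apply, map_add, add_apply, h1, h2, zero_add]
    rwa [Submodule.finrank_eq_zero.1 (hasSignature_gramPP hA).2, Submodule.mem_bot] at h3
  have hdim : Module.finrank ℝ (Idx r s → ℝ) = Module.finrank ℝ ((Idx r s → ℝ) →L[ℝ] ℝ) := by
    rw [← (LinearMap.toContinuousLinearMap : ((Idx r s → ℝ) →ₗ[ℝ] ℝ) ≃ₗ[ℝ] _).finrank_eq]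
    exact Subspace.dual_finrank_eq.symm
  refine ⟨(LinearMap.linearEquivOfInjective _ hinj hdim).toContinuousLinearEquiv, ?_⟩
  ext x y
  rfl

/-- The linear map `N → P` whose graph is the orthogonal complement of `P` for the Gram form. -/
noncomputable def schurShift (A : GraphModel r s ν p' q') : (Fin ν → ℝ) →L[ℝ] (Idx r s → ℝ) :=
  -((gramPP A).inverse.comp (gramNP A))

theorem contDiffOn_schurShift :
    ContDiffOn ℝ ∞ (schurShift : GraphModel r s ν p' q' → _) (schurDomain r s ν p' q') := by
  intro A hA
  obtain ⟨e, he⟩ := exists_equiv_gramPP hA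
  have h1 : ContDiffAt ℝ ∞ ContinuousLinearMap.inverse (gramPP A) :=
    he ▸ contDiffAt_map_inverse e
  exact ((h1.comp A contDiff_gramPP.contDiffAt).clm_comp
    contDiff_gramNP.contDiffAt).neg.contDiffWithinAt

theorem gram_schurShift_left {A : GraphModel r s ν p' q'} (hA : A ∈ schurDomain r s ν p' q')
    (n : Fin ν → ℝ) (x : Idx r s → ℝ) : gram A (schurShift A n, n) (x, 0) = 0 := by
  obtain ⟨e, he⟩ := exists_equiv_gramPP hA
  have h1 : gramPP A (schurShift A n) = -gramNP A n := by
    rw [schurShift, ← he, ContinuousLinearMap.inverse_equiv]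
    simp
  have h2 : (schurShift A n, n) = (schurShift A n, (0 : Fin ν → ℝ)) + ((0 : Idx r s → ℝ), n) := by
    simp
  rw [h2, map_add, add_apply, ← gramPP_apply, ← gramNP_apply, h1]
  simp

/-- The Schur complement of the Gram form, as a bilinear form on `N`. -/
noncomputable def schurForm (A : GraphModel r s ν p' q') :
    (Fin ν → ℝ) →L[ℝ] (Fin ν → ℝ) →L[ℝ] ℝ :=
  pullbackForm (gram A) ((schurShift A).prod (.id ℝ _)) ((schurShift A).prod (.id ℝ _))

theorem schurForm_apply (A : GraphModel r s ν p' q') (n m : Fin ν → ℝ) :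
    schurForm A n m = gram A (schurShift A n, n) (schurShift A m, m) := rfl

/-- The linear map that takes a square matrix to its symmetric part. -/
noncomputable def symPart (ν : ℕ) : (Fin ν → Fin ν → ℝ) →L[ℝ] SymMat ν :=
  LinearMap.toContinuousLinearMap
    { toFun := fun M => ⟨fun j k => (M j k + M k j) / 2, by
        refine Matrix.IsSymm.ext fun j k => ?_
        simp [add_comm]⟩
      map_add' := fun M M' => by
        ext j k
        simp
        ring
      map_smul' := fun c M => by
        ext j k
        simp
        ring }

theorem symPart_apply (ν : ℕ) (M : Fin ν → Fin ν → ℝ) (j k : Fin ν) :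
    (symPart ν M).1 j k = (M j k + M k j) / 2 := rfl

/-- The Schur complement of the Gram form of a graph, as a symmetric matrix. -/
noncomputable def schur (A : GraphModel r s ν p' q') : SymMat ν :=
  symPart ν fun j k => schurForm A (Pi.single j 1) (Pi.single k 1)

theorem schur_apply (A : GraphModel r s ν p' q') (j k : Fin ν) :
    (schur A).1 j k = schurForm A (Pi.single j 1) (Pi.single k 1) := by
  rw [schur, symPart_apply, schurForm_apply, schurForm_apply, gram_comm A (_, Pi.single k 1)]
  ring

theorem contDiffOn_schur :
    ContDiffOn ℝ ∞ (schur : GraphModel r s ν p' q' → _) (schurDomain r s ν p' q') := by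
  refine (symPart ν).contDiff.comp_contDiffOn (contDiffOn_pi.2 fun j => contDiffOn_pi.2 fun k => ?_)
  have h : ∀ l : Fin ν, ContDiffOn ℝ ∞ (fun A : GraphModel r s ν p' q' =>
      ((schurShift A (Pi.single l 1), Pi.single l 1) : (Idx r s → ℝ) × (Fin ν → ℝ)))
      (schurDomain r s ν p' q') := fun l =>
    (contDiffOn_schurShift.clm_apply contDiffOn_const).prodMk contDiffOn_const
  exact (contDiff_gram.contDiffOn.clm_apply (h j)).clm_apply (h k)

theorem form_schur (A : GraphModel r s ν p' q') (n : Fin ν → ℝ) :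
    (schur A).form n = schurForm A n n := by
  have h : LinearMap.toMatrix₂' ℝ (ContinuousLinearMap.coeLM ℝ ∘ₗ (schurForm A).toLinearMap) =
      Matrix.of (schur A).1 := by
    ext j k
    rw [LinearMap.toMatrix₂'_apply, Matrix.of_apply, schur_apply]
    rfl
  rw [SymMat.form, Matrix.toQuadraticForm', ← h, Matrix.toLinearMap₂'_toMatrix']
  rfl

/-- The signature of a graph is the sum of the signature of `P` and that of the Schur complement. -/
theorem hasSignature_gram_iff {A : GraphModel r s ν p' q'} (hA : A ∈ schurDomain r s ν p' q')
    (r' s' : ℕ) : HasSignature (clmQuadratic (gram A)) r' s' ↔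
      r ≤ r' ∧ s ≤ s' ∧ HasSignature (schur A).form (r' - r) (s' - s) := by
  let σ : ((Idx r s → ℝ) × (Fin ν → ℝ)) ≃ₗ[ℝ] ((Idx r s → ℝ) × (Fin ν → ℝ)) :=
    LinearEquiv.ofLinearMap
      ((LinearMap.fst ℝ _ _ + (schurShift A).toLinearMap ∘ₗ LinearMap.snd ℝ _ _).prod
        (LinearMap.snd ℝ _ _))
      ((LinearMap.fst ℝ _ _ - (schurShift A).toLinearMap ∘ₗ LinearMap.snd ℝ _ _).prod
        (LinearMap.snd ℝ _ _)) (by ext <;> simp) (by ext <;> simp)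
  have hσ : ∀ z, σ z = (z.1, 0) + (schurShift A z.2, z.2) := fun z => by simp [σ]
  have h1 : QuadraticMap.Equivalent ((clmQuadratic (gramPP A)).prod (schur A).form)
      (clmQuadratic (gram A)) := ⟨{ σ with
    map_app' := fun z => by
      change clmQuadratic (gram A) (σ z) = _
      rw [hσ, clmQuadratic_apply, QuadraticMap.prod_apply, form_schur, clmQuadratic_apply]
      simp only [map_add, add_apply, gram_schurShift_left hA,
        gram_comm A (z.1, 0) (schurShift A z.2, z.2), schurForm_apply, gramPP_apply]
      ring }⟩
  rw [← HasSignature.congr h1]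
  obtain ⟨⟨h2, h3⟩, -⟩ := hasSignature_gramPP hA
  obtain ⟨h4, h5⟩ := hasSignature_prod (clmQuadratic (gramPP A)) (schur A).form
  simp only [HasSignature, h4, h5, h2, h3]
  omega

/-- The maps `(x, n) ↦ (T n / 2, 0)`, for `T` a symmetric matrix. The factor `1 / 2` compensates for
the two cross terms between `N` and `N*` in the Gram form. -/
noncomputable def schurSection (r s ν p' q' : ℕ) : SymMat ν →L[ℝ] GraphModel r s ν p' q' :=
  LinearMap.toContinuousLinearMap
    { toFun := fun T => (ContinuousLinearMap.inl ℝ _ _).comp ((LinearMap.toContinuousLinearMap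
        ((1 / 2 : ℝ) • (Matrix.of T.1).toLin')).comp (ContinuousLinearMap.snd ℝ _ _))
      map_add' := fun T T' => by
        have h : Matrix.of (T + T').1 = Matrix.of T.1 + Matrix.of T'.1 := rfl
        rw [h, map_add, smul_add, map_add, ContinuousLinearMap.add_comp,
          ContinuousLinearMap.comp_add]
      map_smul' := fun c T => by
        have h : Matrix.of (c • T).1 = c • Matrix.of T.1 := rfl
        rw [h, map_smul Matrix.toLin', smul_comm, map_smul, ContinuousLinearMap.smul_comp,
          ContinuousLinearMap.comp_smul]
        rfl }

theorem schurSection_apply (T : SymMat ν) (z : (Idx r s → ℝ) × (Fin ν → ℝ)) :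
    schurSection r s ν p' q' T z = ((1 / 2 : ℝ) • (Matrix.of T.1).mulVec z.2, 0) := by
  simp [schurSection]

theorem gram_add_schurSection (A : GraphModel r s ν p' q') (T : SymMat ν)
    (z w : (Idx r s → ℝ) × (Fin ν → ℝ)) :
    gram (A + schurSection r s ν p' q' T) z w =
      gram A z w + z.2 ⬝ᵥ (Matrix.of T.1).mulVec w.2 := by
  have h : w.2 ⬝ᵥ (Matrix.of T.1).mulVec z.2 = z.2 ⬝ᵥ (Matrix.of T.1).mulVec w.2 := by
    rw [Matrix.dotProduct_mulVec, ← Matrix.mulVec_transpose, dotProduct_comm]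
    rw [show (Matrix.of T.1).transpose = Matrix.of T.1 from T.2]
  rw [gram_apply, gram_apply, wittForm, wittForm]
  simp only [add_apply, schurSection_apply, Prod.fst_add, Prod.snd_add,
    dotProduct_add, dotProduct_smul, smul_eq_mul, h, add_zero]
  ring

theorem gramPP_add_schurSection (A : GraphModel r s ν p' q') (T : SymMat ν) :
    gramPP (A + schurSection r s ν p' q' T) = gramPP A := by
  ext1 x
  ext1 y
  simp [gramPP_apply, gram_add_schurSection]

theorem gramNP_add_schurSection (A : GraphModel r s ν p' q') (T : SymMat ν) :
    gramNP (A + schurSection r s ν p' q' T) = gramNP A := by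
  ext1 x
  ext1 y
  simp [gramNP_apply, gram_add_schurSection]

theorem add_schurSection_mem_schurDomain {A : GraphModel r s ν p' q'}
    (hA : A ∈ schurDomain r s ν p' q') (T : SymMat ν) :
    A + schurSection r s ν p' q' T ∈ schurDomain r s ν p' q' := by
  rw [schurDomain, mem_preimage, gramPP_add_schurSection]
  exact hA

/-- The Schur complement is affine along `schurSection`, with slope the identity. -/
theorem schur_add_schurSection (A : GraphModel r s ν p' q') (T : SymMat ν) :
    schur (A + schurSection r s ν p' q' T) = schur A + T := by
  apply Subtype.ext
  ext j k
  rw [schur_apply, Submodule.coe_add, Pi.add_apply, Pi.add_apply, schur_apply, schurForm_apply,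
    schurForm_apply, gram_add_schurSection, schurShift, schurShift, gramPP_add_schurSection,
    gramNP_add_schurSection]
  simp

theorem gram_zero (z w : (Idx r s → ℝ) × (Fin ν → ℝ)) :
    gram (0 : GraphModel r s ν p' q') z w = pqForm r s z.1 w.1 := by
  simp [gram_apply, wittForm]

theorem zero_mem_schurDomain : (0 : GraphModel r s ν p' q') ∈ schurDomain r s ν p' q' := by
  have h : gramPP (0 : GraphModel r s ν p' q') = pqCLM r s := by
    ext1 x
    ext1 y
    rw [gramPP_apply, gram_zero, pqCLM_apply]
  rw [schurDomain, mem_preimage, h]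
  exact Metric.mem_ball_self one_pos

end Schur

/-! ### Straightening a map that is affine along a linear section -/

section Straighten

variable {E K F : Type*} [NormedAddCommGroup E] [NormedSpace ℝ E] [NormedAddCommGroup K]
  [NormedSpace ℝ K] [NormedAddCommGroup F] [NormedSpace ℝ F]

/-- If `S` satisfies `S (A + L T) = S A + T`, then `S` together with the projection along `L` is a
smooth chart: the inverse is explicit, and no inverse function theorem is needed. -/
theorem exists_straightening {U : Set E} (hU : IsOpen U) {S : E → F} (hS : ContDiffOn ℝ ∞ S U)
    (L : F →L[ℝ] E) (Θ : E ≃L[ℝ] K × F) (hΘ : ∀ T, Θ.symm (0, T) = L T)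
    (hUL : ∀ A ∈ U, ∀ T, A + L T ∈ U) (hSL : ∀ A ∈ U, ∀ T, S (A + L T) = S A + T) :
    ∃ ψ : OpenPartialHomeomorph E (K × F), ψ.source = U ∧ (∀ A, ψ A = ((Θ A).1, S A)) ∧
      (∀ z ∈ ψ.target, ∀ T, (z.1, T) ∈ ψ.target) ∧ ContDiffOn ℝ ∞ ψ ψ.source ∧
      ContDiffOn ℝ ∞ ψ.symm ψ.target := by
  have hbase : ∀ A, Θ.symm ((Θ A).1, 0) = A + L (-(Θ A).2) := by
    intro A
    rw [← hΘ, ← sub_eq_iff_eq_add, ← map_sub]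
    simp
  have hbaseU : ∀ A ∈ U, Θ.symm ((Θ A).1, 0) ∈ U := fun A hA => hbase A ▸ hUL A hA _
  have hfst : ∀ k T, (Θ (Θ.symm (k, 0) + L T)).1 = k := by
    intro k T
    rw [map_add, ← hΘ]
    simp
  have hlin : ContDiff ℝ ∞ fun z : K × F => Θ.symm (z.1, (0 : F)) :=
    Θ.symm.contDiff.comp (contDiff_fst.prodMk contDiff_const)
  have h1 : ContDiffOn ℝ ∞ (fun A => ((Θ A).1, S A)) U :=
    (contDiff_fst.comp Θ.contDiff).contDiffOn.prodMk hS
  have h2 : ContDiffOn ℝ ∞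
      (fun z : K × F => Θ.symm (z.1, (0 : F)) + L (z.2 - S (Θ.symm (z.1, (0 : F)))))
      {z | Θ.symm (z.1, (0 : F)) ∈ U} :=
    hlin.contDiffOn.add (L.contDiff.comp_contDiffOn
      (contDiff_snd.contDiffOn.sub (hS.comp hlin.contDiffOn fun z hz => hz)))
  refine ⟨{
    toFun := fun A => ((Θ A).1, S A)
    invFun := fun z => Θ.symm (z.1, 0) + L (z.2 - S (Θ.symm (z.1, 0)))
    source := U
    target := {z | Θ.symm (z.1, 0) ∈ U}
    map_source' := hbaseU
    map_target' := fun z hz => hUL _ hz _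
    left_inv' := fun A hA => ?_
    right_inv' := fun z hz => ?_
    open_source := hU
    open_target := hU.preimage hlin.continuous
    continuousOn_toFun := h1.continuousOn
    continuousOn_invFun := h2.continuousOn }, rfl, fun A => rfl, fun z hz T => hz, h1, h2⟩
  · simp only
    rw [hbase, hSL A hA, add_assoc, ← map_add]
    simp
  · rw [hSL _ hz, hfst]
    simp

theorem exists_equiv_prod_of_injective [FiniteDimensional ℝ E] [FiniteDimensional ℝ F]
    [FiniteDimensional ℝ K] (L : F →L[ℝ] E) (hL : Function.Injective L)
    (hd : Module.finrank ℝ E = Module.finrank ℝ K + Module.finrank ℝ F) :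
    ∃ Θ : E ≃L[ℝ] K × F, ∀ T, Θ.symm (0, T) = L T := by
  obtain ⟨C, hC⟩ := (LinearMap.range L.toLinearMap).exists_isCompl
  have h1 := Submodule.finrank_add_eq_of_isCompl hC
  have h2 : Module.finrank ℝ (LinearMap.range L.toLinearMap) = Module.finrank ℝ F :=
    LinearMap.finrank_range_of_inj hL
  let f : K ≃ₗ[ℝ] C := LinearEquiv.ofFinrankEq _ _ (by omega)
  let e : (K × F) ≃ₗ[ℝ] E := (f.prodCongr (LinearEquiv.ofInjective L.toLinearMap hL)).trans
    (Submodule.prodEquivOfIsCompl _ _ hC.symm)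
  refine ⟨e.symm.toContinuousLinearEquiv, fun T => ?_⟩
  change e (0, T) = L T
  simp [e]

end Straighten

/-! ### Slice charts of the orbits -/

section OrbitCharts

variable {p q i r s ν p' q' : ℕ}

theorem SymMat.hasSignature_form_zero_iff (S : SymMat ν) : HasSignature S.form 0 0 ↔ S = 0 := by
  constructor
  · intro h
    obtain ⟨f, hf⟩ := exists_equiv_pqForm (ν := ν) h (by simp)
    let B : LinearMap.BilinForm ℝ (Fin ν → ℝ) := Matrix.toLinearMap₂' ℝ (Matrix.of S.1)
    have h1 : ∀ x, B x x = 0 := fun x => (hf x).trans (by simp [pqForm_apply])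
    have h2 : ∀ x y, B x y = B y x := by
      intro x y
      simp only [B]
      rw [Matrix.toLinearMap₂'_apply', Matrix.toLinearMap₂'_apply', Matrix.dotProduct_mulVec,
        ← Matrix.mulVec_transpose, dotProduct_comm,
        show (Matrix.of S.1).transpose = Matrix.of S.1 from S.2]
    apply Subtype.ext
    ext j k
    have h3 := bilin_ext_of_diag (B := B) (C := 0) h2
      (fun _ _ => rfl) h1 (Pi.single j 1) (Pi.single k 1)
    simpa [B, Matrix.toLinearMap₂'_apply'] using h3
  · rintro rfl
    have h1 : ∀ x, (0 : SymMat ν).form x = 0 := fun x => by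
      rw [SymMat.form, Matrix.toQuadraticForm', LinearMap.BilinMap.toQuadraticMap_apply,
        Matrix.toLinearMap₂'_apply']
      change x ⬝ᵥ (0 : Matrix (Fin ν) (Fin ν) ℝ).mulVec x = 0
      simp
    have h2 := QuadraticForm.sigPos_add_sigNeg_add_radical (Q := (0 : SymMat ν).form)
    have h3 : (0 : SymMat ν).form.radical = ⊤ := by
      rw [eq_top_iff]
      intro x _
      rw [QuadraticMap.mem_radical_iff']
      simp [h1]
    rw [h3, finrank_top] at h2
    exact ⟨by omega, by omega⟩

/-- `W` is the graph of `B` in the coordinates of a Witt frame. -/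
def WittFrame.IsGraph {W₀ : Submodule ℝ (Idx p q → ℝ)} (F : WittFrame p q r s ν p' q' W₀)
    (W : Submodule ℝ (Idx p q → ℝ)) (B : GraphModel r s ν p' q') : Prop :=
  ∀ v, v ∈ W ↔ (F.e v).2 = B (F.e v).1

theorem WittFrame.IsGraph.equivalent_gram {W₀ W : Submodule ℝ (Idx p q → ℝ)}
    {F : WittFrame p q r s ν p' q' W₀} {B : GraphModel r s ν p' q'} (h : F.IsGraph W B) :
    QuadraticMap.Equivalent ((Ipq p q).toQuadraticForm'.restrict W) (clmQuadratic (gram B)) := by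
  let f : W →ₗ[ℝ] (Idx r s → ℝ) × (Fin ν → ℝ) :=
    LinearMap.fst ℝ _ _ ∘ₗ F.e.toLinearMap ∘ₗ W.subtype
  let g : ((Idx r s → ℝ) × (Fin ν → ℝ)) →ₗ[ℝ] W :=
    (F.e.symm.toLinearMap ∘ₗ LinearMap.id.prod B.toLinearMap).codRestrict W fun z => by
      rw [h]
      simp
  have hfg : f ∘ₗ g = LinearMap.id := LinearMap.ext fun z => by simp [f, g]
  have hgf : g ∘ₗ f = LinearMap.id := by
    refine LinearMap.ext fun v => Subtype.ext ?_
    have h1 : ((F.e v).1, B (F.e v).1) = F.e v := Prod.ext rfl ((h v).1 v.2).symm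
    change F.e.symm ((F.e v).1, B (F.e v).1) = v
    rw [h1, LinearEquiv.symm_apply_apply]
  let σ : W ≃ₗ[ℝ] (Idx r s → ℝ) × (Fin ν → ℝ) := LinearEquiv.ofLinearMap f g hfg hgf
  refine ⟨{ σ with map_app' := fun v => ?_ }⟩
  have h1 : ((F.e v).1, B (F.e v).1) = F.e v := Prod.ext rfl ((h v).1 v.2).symm
  change gram B (F.e v).1 (F.e v).1 = pqForm p q v v
  rw [gram_apply, h1, F.form]

theorem exists_graph_chart {x : Gr (Idx p q → ℝ) i} (F : WittFrame p q r s ν p' q' x.1)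
    (hi : i = r + s + ν) :
    ∃ (χ : OpenPartialHomeomorph (Gr (Idx p q → ℝ) i) (GrModel p q i))
      (a : GrModel p q i ≃L[ℝ] GraphModel r s ν p' q'),
      χ ∈ IsManifold.maximalAtlas 𝓘(ℝ, GrModel p q i) ∞ (Gr (Idx p q → ℝ) i) ∧
      χ.target = univ ∧ x ∈ χ.source ∧ a (χ x) = 0 ∧
      ∀ y ∈ χ.source, F.IsGraph y.1 (a (χ y)) := by
  have hd := F.dim_eq
  let α : (Fin i → ℝ) ≃L[ℝ] ((Idx r s → ℝ) × (Fin ν → ℝ)) :=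
    ContinuousLinearEquiv.ofFinrankEq (by simp [hi])
  let β : (Fin (Module.finrank ℝ (Idx p q → ℝ) - i) → ℝ) ≃L[ℝ]
      ((Fin ν → ℝ) × (Idx p' q' → ℝ)) :=
    ContinuousLinearEquiv.ofFinrankEq (by simp; omega)
  let e := F.e.trans (α.symm.toLinearEquiv.prodCongr β.symm.toLinearEquiv)
  let χ : OpenPartialHomeomorph (Gr (Idx p q → ℝ) i) (GrModel p q i) :=
    (Gr.chartedSpaceCore (Idx p q → ℝ) i).openPartialHomeomorph (Gr.chart e) (mem_range_self e)
  let a : GrModel p q i ≃L[ℝ] GraphModel r s ν p' q' := α.arrowCongr β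
  have hχ : χ.source = range (Gr.param e) := Gr.chart_source e
  have hχp : ∀ A, χ (Gr.param e A) = A := Gr.chart_param e
  have hgraph : ∀ A, F.IsGraph (Gr.param e A).1 (a A) := by
    intro A v
    rw [Gr.mem_param]
    change β.symm (F.e v).2 = A (α.symm (F.e v).1) ↔ (F.e v).2 = β (A (α.symm (F.e v).1))
    rw [β.symm_apply_eq]
  have hx0 : Gr.param e 0 = x := by
    apply Subtype.ext
    ext v
    rw [hgraph 0 v, F.mem_iff]
    simp
  refine ⟨χ, a, IsManifold.subset_maximalAtlas ?_, rfl, ?_, ?_, ?_⟩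
  · exact mem_iUnion₂.2 ⟨Gr.chart e, mem_range_self e, rfl⟩
  · rw [hχ, ← hx0]
    exact mem_range_self _
  · rw [← hx0, hχp, map_zero]
  · intro y hy
    rw [hχ] at hy
    obtain ⟨A, rfl⟩ := hy
    rw [hχp]
    exact hgraph A

theorem schurSection_injective : Function.Injective (schurSection r s ν p' q') := by
  intro T T' h
  have h1 := schur_add_schurSection (0 : GraphModel r s ν p' q') T
  rw [h, schur_add_schurSection] at h1
  exact (add_left_cancel h1).symm

/-- The slice charts at a point of signature `(r, s)`: the second component is the Schur complement
of the Gram matrix. -/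
theorem exists_sliceChart {K : Type*} [NormedAddCommGroup K] [NormedSpace ℝ K]
    [FiniteDimensional ℝ K] (Θ : GrModel p q i ≃L[ℝ] K × SymMat ν) {x : Gr (Idx p q → ℝ) i}
    (F : WittFrame p q r s ν p' q' x.1) (hi : i = r + s + ν) {O : Set (Gr (Idx p q → ℝ) i)}
    (hO : O ⊆ orbitOfType p q i r s)
    (hO' : ∀ y ∈ orbitOfType p q i r s, ∀ B, F.IsGraph y.1 B → y ∈ O) :
    ∃ c : SliceChart Θ O, x ∈ c.chart.source ∧ ∀ y ∈ c.chart.source, ∀ r' s' : ℕ,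
      y ∈ orbitOfType p q i r' s' ↔
        r ≤ r' ∧ s ≤ s' ∧ HasSignature (Θ (c.chart y)).2.form (r' - r) (s' - s) := by
  obtain ⟨χ, a, hχ, hχt, hxχ, hx0, hgraph⟩ := exists_graph_chart F hi
  let L : SymMat ν →L[ℝ] GrModel p q i :=
    (a.symm : GraphModel r s ν p' q' →L[ℝ] GrModel p q i).comp (schurSection r s ν p' q')
  have hL : ∀ T, a (L T) = schurSection r s ν p' q' T := fun T => a.apply_symm_apply _
  obtain ⟨Θ', hΘ'⟩ := exists_equiv_prod_of_injective (K := K) L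
    (a.symm.injective.comp schurSection_injective) (by
      rw [Θ.toLinearEquiv.finrank_eq, Module.finrank_prod])
  obtain ⟨ψ, hψs, hψ, hψt, hψ1, hψ2⟩ := exists_straightening
    (isOpen_schurDomain.preimage a.continuous) (S := fun A => schur (a A))
    (contDiffOn_schur.comp a.contDiff.contDiffOn fun A hA => hA) L Θ' hΘ'
    (fun A hA T => by
      rw [mem_preimage, map_add, hL]
      exact add_schurSection_mem_schurDomain hA T)
    (fun A _ T => by rw [map_add, hL, schur_add_schurSection])
  let C : OpenPartialHomeomorph (Gr (Idx p q → ℝ) i) (GrModel p q i) :=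
    (χ.trans ψ).trans Θ.symm.toHomeomorph.toOpenPartialHomeomorph
  have hCs : C.source = χ.source ∩ χ ⁻¹' (a ⁻¹' schurDomain r s ν p' q') := by
    simp [C, hψs]
  have hCt : C.target = Θ ⁻¹' ψ.target := by
    ext z
    simp [C, hχt]
  have hC : ∀ y, Θ (C y) = ((Θ' (χ y)).1, schur (a (χ y))) := by
    intro y
    rw [← hψ]
    exact Θ.apply_symm_apply _
  have hsig : ∀ y ∈ C.source, ∀ r' s' : ℕ, y ∈ orbitOfType p q i r' s' ↔
      r ≤ r' ∧ s ≤ s' ∧ HasSignature (Θ (C y)).2.form (r' - r) (s' - s) := by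
    intro y hy r' s'
    rw [hCs] at hy
    rw [hC, ← hasSignature_gram_iff hy.2]
    exact HasSignature.congr (hgraph y hy.1).equivalent_gram r' s'
  have hCatlas : C ∈ IsManifold.maximalAtlas 𝓘(ℝ, GrModel p q i) ∞ (Gr (Idx p q → ℝ) i) := by
    refine C.mem_maximalAtlas_of_contMDiffOn ?_ ?_
    · have h1 := (contMDiffOn_of_mem_maximalAtlas hχ).mono
        (hCs.trans_subset inter_subset_left)
      have h2 : ContMDiffOn 𝓘(ℝ, GrModel p q i) 𝓘(ℝ, GrModel p q i) ∞ (fun A => Θ.symm (ψ A))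
          ψ.source := (Θ.symm.contDiff.comp_contDiffOn hψ1).contMDiffOn
      refine h2.comp h1 fun y hy => ?_
      rw [hCs] at hy
      have h3 : χ y ∈ ψ.source := by rw [hψs]; exact hy.2
      exact h3
    · have h1 := contMDiffOn_symm_of_mem_maximalAtlas hχ
      have h2 : ContMDiffOn 𝓘(ℝ, GrModel p q i) 𝓘(ℝ, GrModel p q i) ∞ (fun z => ψ.symm (Θ z))
          C.target :=
        (hψ2.comp Θ.contDiff.contDiffOn fun z hz => by rwa [hCt] at hz).contMDiffOn
      exact h1.comp h2 fun z hz => by simp [hχt]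
  refine ⟨⟨C, hCatlas, fun y hy => ?_, fun z hz T => ?_⟩, ?_, hsig⟩
  · have h1 := hsig y hy r s
    simp only [le_refl, true_and, Nat.sub_self, SymMat.hasSignature_form_zero_iff] at h1
    rw [← h1]
    rw [hCs] at hy
    exact ⟨fun h => hO h, fun h => hO' y h _ (hgraph y hy.1)⟩
  · rw [hCt] at hz ⊢
    simpa using hψt _ hz T
  · rw [hCs]
    refine ⟨hxχ, ?_⟩
    rw [mem_preimage, mem_preimage, hx0]
    exact zero_mem_schurDomain

theorem finrank_symMat_le {x : Gr (Idx p q → ℝ) i} (F : WittFrame p q r s ν p' q' x.1)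
    (hi : i = r + s + ν) :
    Module.finrank ℝ (SymMat ν) ≤ Module.finrank ℝ (GrModel p q i) := by
  obtain ⟨-, a, -⟩ := exists_graph_chart F hi
  exact LinearMap.finrank_le_finrank_of_injective
    (f := a.symm.toLinearMap ∘ₗ (schurSection r s ν p' q').toLinearMap)
    (a.symm.injective.comp schurSection_injective)

end OrbitCharts

/-! ### The orbits as submanifolds -/

section Conclusion

variable {p q i r s : ℕ}

/-- Orbits are open in `orbitOfType`: a subspace of signature `(r, s)` that is a graph over a point of
an orbit belongs to this orbit. -/
theorem mem_orbit_of_isGraph {ν p' q' : ℕ} {x₀ x y : Gr (Idx p q → ℝ) i}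
    (hx₀ : x₀ ∈ orbitOfType p q i r s) (hx : x ∈ MulAction.orbit (SO p q) x₀)
    (F : WittFrame p q r s ν p' q' x.1) (hi : i = r + s + ν) (hy : y ∈ orbitOfType p q i r s)
    {B : GraphModel r s ν p' q'} (h : F.IsGraph y.1 B) : y ∈ MulAction.orbit (SO p q) x₀ := by
  by_cases hex : 0 < p ∧ p = q ∧ i = p ∧ r = 0 ∧ s = 0
  · obtain ⟨-, hpq, hip, rfl, rfl⟩ := hex
    have hd := F.dim_eq
    obtain rfl : p' = 0 := by omega
    obtain rfl : q' = 0 := by omega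
    rw [← MulAction.orbit_eq_iff.2 hx]
    exact F.mem_orbit_of_graph B.toLinearMap h hy
  · exact mem_orbit_of_mem_orbitOfType hx₀ hy hex

/-- The hypothesis `hO'` says that `O` is open in `orbitOfType p q i r s`. -/
theorem exists_manifold_structure {O : Set (Gr (Idx p q → ℝ) i)}
    (hO : O ⊆ orbitOfType p q i r s)
    (hO' : ∀ x ∈ O, ∀ y ∈ orbitOfType p q i r s, ∀ p' q'
      (F : WittFrame p q r s (i - r - s) p' q' x.1) (B : GraphModel r s (i - r - s) p' q'),
      F.IsGraph y.1 B → y ∈ O) :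
    ∃ (d : ℕ) (_ : ChartedSpace (EuclideanSpace ℝ (Fin d)) O),
      IsManifold 𝓘(ℝ, EuclideanSpace ℝ (Fin d)) ∞ O ∧
      IsSmoothEmbedding 𝓘(ℝ, EuclideanSpace ℝ (Fin d)) 𝓘(ℝ, GrModel p q i) ∞
        (Subtype.val : O → Gr (Idx p q → ℝ) i) ∧
      ∀ x ∈ O, ∃ φ : OpenPartialHomeomorph (Gr (Idx p q → ℝ) i) (O × SymMat (i - r - s)),
        x ∈ φ.source ∧
        ContMDiffOn 𝓘(ℝ, GrModel p q i)
          (𝓘(ℝ, EuclideanSpace ℝ (Fin d)).prod 𝓘(ℝ, SymMat (i - r - s))) ∞ φ φ.source ∧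
        ContMDiffOn (𝓘(ℝ, EuclideanSpace ℝ (Fin d)).prod 𝓘(ℝ, SymMat (i - r - s)))
          𝓘(ℝ, GrModel p q i) ∞ φ.symm φ.target ∧
        {z : O × SymMat (i - r - s) | z.1.1 ∈ φ.source ∧ z.2 = 0} ⊆ φ.target ∧
        φ.target ⊆ {z : O × SymMat (i - r - s) | z.1.1 ∈ φ.source} ∧
        (φ.source ⊆ ⋃ (r' : ℕ) (s' : ℕ) (_ : r ≤ r' ∧ s ≤ s'), orbitOfType p q i r' s') ∧
        ∀ y ∈ φ.source, ∀ r' s' : ℕ,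
          y ∈ orbitOfType p q i r' s' ↔
            r ≤ r' ∧ s ≤ s' ∧ HasSignature (φ y).2.form (r' - r) (s' - s) := by
  -- If `O` is empty, then `i - r - s` may be a truncated difference; any `d` serves.
  rcases O.eq_empty_or_nonempty with rfl | ⟨x₀, hx₀⟩
  · let : ChartedSpace (EuclideanSpace ℝ (Fin 0)) (∅ : Set (Gr (Idx p q → ℝ) i)) :=
      ChartedSpace.empty _ _
    refine ⟨0, inferInstance, ?_, ⟨?_, Topology.IsEmbedding.subtypeVal⟩, fun x hx => hx.elim⟩
    · exact isManifold_of_contDiffOn _ _ _ fun e e' he => he.elim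
    · have h : IsImmersionOfComplement ℝ 𝓘(ℝ, EuclideanSpace ℝ (Fin 0)) 𝓘(ℝ, GrModel p q i) ∞
          (Subtype.val : (∅ : Set (Gr (Idx p q → ℝ) i)) → Gr (Idx p q → ℝ) i) :=
        fun x => x.2.elim
      exact h.isImmersion
  · obtain ⟨hi, p', q', ⟨F₀⟩⟩ := exists_wittFrame_of_mem (hO hx₀)
    have hle := finrank_symMat_le F₀ hi
    set d := Module.finrank ℝ (GrModel p q i) - Module.finrank ℝ (SymMat (i - r - s)) with hd
    let Θ : GrModel p q i ≃L[ℝ] EuclideanSpace ℝ (Fin d) × SymMat (i - r - s) :=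
      ContinuousLinearEquiv.ofFinrankEq (by
        rw [Module.finrank_prod, finrank_euclideanSpace_fin]
        omega)
    have hc : ∀ x : O, ∃ c : SliceChart Θ O, x.1 ∈ c.chart.source ∧
        ∀ y ∈ c.chart.source, ∀ r' s' : ℕ, y ∈ orbitOfType p q i r' s' ↔
          r ≤ r' ∧ s ≤ s' ∧ HasSignature (Θ (c.chart y)).2.form (r' - r) (s' - s) := by
      intro x
      obtain ⟨-, p', q', ⟨F⟩⟩ := exists_wittFrame_of_mem (hO x.2)
      exact exists_sliceChart Θ F hi hO fun y hy B hB => hO' x.1 x.2 y hy p' q' F B hB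
    choose C hC hsig using hc
    refine ⟨d, SliceChart.chartedSpace C hC, SliceChart.isManifold C hC,
      SliceChart.isSmoothEmbedding_val C hC, fun x hx => ⟨(C ⟨x, hx⟩).tube ⟨x, hx⟩, ?_,
        SliceChart.contMDiffOn_tube C hC _, SliceChart.contMDiffOn_tube_symm C hC _, ?_, ?_, ?_, ?_⟩⟩
    · rw [SliceChart.tube_source]
      exact hC ⟨x, hx⟩
    · rw [SliceChart.tube_source, SliceChart.tube_target]
      exact fun z hz => hz.1
    · rw [SliceChart.tube_source, SliceChart.tube_target]
    · rw [SliceChart.tube_source]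
      intro y hy
      have h1 := (hsig ⟨x, hx⟩ y hy (sigPos ((Ipq p q).toQuadraticForm'.restrict y.1))
        (sigNeg ((Ipq p q).toQuadraticForm'.restrict y.1))).1 ⟨rfl, rfl⟩
      simp only [mem_iUnion]
      exact ⟨_, _, ⟨h1.1, h1.2.1⟩, ⟨rfl, rfl⟩⟩
    · rw [SliceChart.tube_source]
      intro y hy r' s'
      rw [SliceChart.tube_snd]
      exact hsig ⟨x, hx⟩ y hy r' s'

end Conclusion

theorem corollary3p3 (p q i r s : ℕ) :
    (∀ x ∈ orbitOfType p q i r s,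
      MulAction.orbit (SO p q) x ⊆ orbitOfType p q i r s ∧
      (¬ (0 < p ∧ p = q ∧ i = p ∧ r = 0 ∧ s = 0) →
        MulAction.orbit (SO p q) x = orbitOfType p q i r s)) ∧
    ∀ O : Set (Gr (Idx p q → ℝ) i),
      (O = orbitOfType p q i r s ∨
        ∃ x ∈ orbitOfType p q i r s, O = MulAction.orbit (SO p q) x) →
      ∃ (d : ℕ) (_ : ChartedSpace (EuclideanSpace ℝ (Fin d)) O),
        IsManifold 𝓘(ℝ, EuclideanSpace ℝ (Fin d)) ∞ O ∧
        IsSmoothEmbedding 𝓘(ℝ, EuclideanSpace ℝ (Fin d)) 𝓘(ℝ, GrModel p q i) ∞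
          (Subtype.val : O → Gr (Idx p q → ℝ) i) ∧
        ∀ x ∈ O, ∃ φ : OpenPartialHomeomorph (Gr (Idx p q → ℝ) i) (O × SymMat (i - r - s)),
          x ∈ φ.source ∧
          ContMDiffOn 𝓘(ℝ, GrModel p q i)
            (𝓘(ℝ, EuclideanSpace ℝ (Fin d)).prod 𝓘(ℝ, SymMat (i - r - s))) ∞ φ φ.source ∧
          ContMDiffOn (𝓘(ℝ, EuclideanSpace ℝ (Fin d)).prod 𝓘(ℝ, SymMat (i - r - s)))
            𝓘(ℝ, GrModel p q i) ∞ φ.symm φ.target ∧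
          {z : O × SymMat (i - r - s) | z.1.1 ∈ φ.source ∧ z.2 = 0} ⊆ φ.target ∧
          φ.target ⊆ {z : O × SymMat (i - r - s) | z.1.1 ∈ φ.source} ∧
          (φ.source ⊆ ⋃ (r' : ℕ) (s' : ℕ) (_ : r ≤ r' ∧ s ≤ s'), orbitOfType p q i r' s') ∧
          ∀ y ∈ φ.source, ∀ r' s' : ℕ,
            y ∈ orbitOfType p q i r' s' ↔
              r ≤ r' ∧ s ≤ s' ∧ HasSignature (φ y).2.form (r' - r) (s' - s) := by
  refine ⟨fun x hx => ⟨orbit_subset_orbitOfType hx, fun h =>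
    (orbit_subset_orbitOfType hx).antisymm fun y hy => mem_orbit_of_mem_orbitOfType hx hy h⟩, ?_⟩
  rintro O (rfl | ⟨x₀, hx₀, rfl⟩)
  · exact exists_manifold_structure subset_rfl fun x _ y hy _ _ _ _ _ => hy
  · refine exists_manifold_structure (orbit_subset_orbitOfType hx₀) fun x hx y hy p' q' F B hB => ?_
    exact mem_orbit_of_isGraph hx₀ hx F (exists_wittFrame_of_mem hx₀).1 hy hB
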